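/- Let $X$ be a finite-dimensional Noetherian separated scheme (for example over a field), and let $\mathcal{U}=\{U_h\}_{h\in H}$ be an open affine covering of $X$. Let $\mathcal{N}$ be its nerve, i.e. the set of finite nonempty subsets $\alpha=\{h_0,\dots,h_k\}\subseteq H$ with $U_\alpha:=U_{h_0}\cap\dots\cap U_{h_k}\neq\emptyset$, partially ordered by inclusion, and put $A_\alpha=\Gamma(U_\alpha,\mathcal{O}_X)$, so that for $\alpha\le\beta$ there is a restriction map $A_\alpha\to A_\beta$. Let $\operatorname{DGMod}(R)$ denote the category of unbounded cochain complexes of $R$-modules. An $A_{\boldsymbol{\cdot}}$-module $\mathcal{F}$ consists of objects $\mathcal{F}_\alpha\in\operatorname{DGMod}(A_\alpha)$ for $\alpha\in\mathcal{N}$ and morphisms $f_{\alpha\beta}\colon\mathcal{F}_\alpha\otimes_{A_\alpha}A_\beta\to\mathcal{F}_\beta$ in $\operatorname{DGMod}(A_\beta)$ for $\alpha\le\beta$, with $f_{\alpha\alpha}$ the canonical isomorphism $\mathcal{F}_\alpha\otimes_{A_\alpha}A_\alpha\cong\mathcal{F}_\alpha$ and $f_{\beta\gamma}\circ(f_{\alpha\beta}\otimes_{A_\beta}A_\gamma)=f_{\alpha\gamma}$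 for $\alpha\le\beta\le\gamma$. A morphism $\varphi\colon\mathcal{F}\to\mathcal{G}$ is a family of morphisms $\varphi_\alpha\colon\mathcal{F}_\alpha\to\mathcal{G}_\alpha$ in $\operatorname{DGMod}(A_\alpha)$ with $g_{\alpha\beta}\circ(\varphi_\alpha\otimes_{A_\alpha} A_\beta)=\varphi_\beta\circ f_{\alpha\beta}$ for $\alpha\le\beta$. Let $\mathbf{Mod}(A_{\boldsymbol{\cdot}})$ be the resulting category. The latching module of $\mathcal{F}$ at $\alpha$ is $L_\alpha\mathcal{F}=\operatorname{colim}_{\gamma<\alpha}(\mathcal{F}_\gamma\otimes_{A_\gamma}A_\alpha)$; it comes with a natural map $L_\alpha\mathcal{F}\to\mathcal{F}_\alpha$. A morphism in $\operatorname{DGMod}(R)$ is a cofibration if it has the left lifting property with respect to all degreewise surjective quasi-isomorphisms, i.e. if it is a cofibration of the projective model structure. Theorem. The category $\mathbf{Mod}(A_{\boldsymbol{\cdot}})$ has all small limits and colimits, and it carries a model structure, with functorial factorizations, in which a morphism $\varphi\colon\mathcal{F}\to\mathcal{G}$ is 1. a weak equivalence if and only if $\varphi_\alpha\colon\mathcal{F}_\alpha\to\mathcal{G}_\alpha$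 is a quasi-isomorphism for every $\alpha\in\mathcal{N}$; 2. a fibration if and only if $\varphi_\alpha\colon\mathcal{F}_\alpha\to\mathcal{G}_\alpha$ is surjective in each degree for every $\alpha\in\mathcal{N}$; 3. a cofibration if and only if the natural morphism $L_\alpha\mathcal{G}\amalg_{L_\alpha\mathcal{F}}\mathcal{F}_\alpha\to\mathcal{G}_\alpha$ is a cofibration in $\operatorname{DGMod}(A_\alpha)$ for every $\alpha\in\mathcal{N}$. -/

import Mathlib

open CategoryTheory CategoryTheory.Limits AlgebraicGeometry HomotopicalAlgebra

universe u

noncomputable section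

/-- Unbounded cochain complexes of `R`-modules, i.e. DG-modules over the commutative ring `R`. -/
abbrev DGMod (R : CommRingCat.{u}) : Type (u + 1) := CochainComplex (ModuleCat.{u} R) ℤ

namespace DGMod

section Modules

variable {R S T T' : Type u} [CommRing R] [CommRing S] [CommRing T] [CommRing T']

/-- Extension of scalars of modules along a homomorphism of commutative rings. -/
abbrev ext₀ (f : R →+* S) : ModuleCat.{u} R ⥤ ModuleCat.{u} S :=
  ModuleCat.extendScalars.{u, u, u} f

/-- `M ⊗_R R ≅ M`. -/
def extIdIso (f : R →+* R) (e : f = RingHom.id R) (M : ModuleCat.{u} R) : (ext₀ f).obj M ≅ M :=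
  eqToIso (by rw [e]) ≪≫ (ModuleCat.extendScalarsId R).app M

/-- `M ⊗_R T ≅ (M ⊗_R S) ⊗_S T` for ring homomorphisms `R → S → T` with composition `h`. -/
def extCompIso (f : R →+* S) (g : S →+* T) (h : R →+* T) (e : g.comp f = h)
    (M : ModuleCat.{u} R) :
    (ext₀ h).obj M ≅ (ext₀ g).obj ((ext₀ f).obj M) :=
  eqToIso (by rw [← e]) ≪≫ (ModuleCat.extendScalarsComp f g).app M

lemma extIdIso_naturality (f : R →+* R) (e : f = RingHom.id R)
    {M M' : ModuleCat.{u} R} (a : M ⟶ M') :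
    (ext₀ f).map a ≫ (extIdIso f e M').hom = (extIdIso f e M).hom ≫ a := by
  subst e
  simp only [extIdIso, eqToIso_refl, Iso.refl_trans]
  exact (ModuleCat.extendScalarsId R).hom.naturality a

lemma extCompIso_naturality (f : R →+* S) (g : S →+* T) (h : R →+* T) (e : g.comp f = h)
    {M M' : ModuleCat.{u} R} (a : M ⟶ M') :
    (ext₀ h).map a ≫ (extCompIso f g h e M').hom =
      (extCompIso f g h e M).hom ≫ (ext₀ g).map ((ext₀ f).map a) := by
  subst e
  simp only [extCompIso, eqToIso_refl, Iso.refl_trans]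
  exact (ModuleCat.extendScalarsComp f g).hom.naturality a

lemma extCompIso_id (f : R →+* R) (g : R →+* S) (e : f = RingHom.id R) (e' : g.comp f = g)
    (M : ModuleCat.{u} R) :
    (extCompIso f g g e' M).hom ≫ (ext₀ g).map (extIdIso f e M).hom = 𝟙 _ := by
  subst e
  have := NatTrans.congr_app (ModuleCat.extendScalars_id_comp g) M
  simp only [NatTrans.comp_app, Functor.whiskerRight_app, Functor.leftUnitor_hom_app,
    NatTrans.id_app] at this
  simp only [extCompIso, extIdIso, eqToIso_refl, Iso.refl_trans]
  exact this

lemma extCompIso_assoc (f : R →+* S) (g : S →+* T) (k : T →+* T') (fg : R →+* T) (gk : S →+* T')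
    (fgk : R →+* T') (e₁ : g.comp f = fg) (e₂ : k.comp g = gk) (e₃ : k.comp fg = fgk)
    (e₄ : gk.comp f = fgk) (M : ModuleCat.{u} R) :
    (extCompIso fg k fgk e₃ M).hom ≫ (ext₀ k).map (extCompIso f g fg e₁ M).hom =
      (extCompIso f gk fgk e₄ M).hom ≫ (extCompIso g k gk e₂ ((ext₀ f).obj M)).hom := by
  subst e₁ e₂ e₃
  have := NatTrans.congr_app (ModuleCat.extendScalars_assoc f g k) M
  simp only [NatTrans.comp_app, Functor.whiskerRight_app, Functor.whiskerLeft_app,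
    Functor.associator_inv_app] at this
  simp only [extCompIso, eqToIso_refl, Iso.refl_trans]
  exact this

instance (f : R →+* S) : (ModuleCat.extendScalars.{u, u, u} f).Additive :=
  (ModuleCat.extendRestrictScalarsAdj.{u, u, u} f).left_adjoint_additive

end Modules

section Complexes

variable {R S T T' : CommRingCat.{u}}

lemma hom_eq_id {f : R ⟶ R} (e : f = 𝟙 R) : f.hom = RingHom.id R := by
  rw [e, CommRingCat.hom_id]

lemma hom_comp_eq {f : R ⟶ S} {g : S ⟶ T} {h : R ⟶ T} (e : f ≫ g = h) :
    g.hom.comp f.hom = h.hom := by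
  rw [← e, CommRingCat.hom_comp]

/-- Extension of scalars `- ⊗_R S : DGMod R ⥤ DGMod S`, in each degree. -/
def extend (f : R ⟶ S) : DGMod R ⥤ DGMod S :=
  (ext₀ f.hom).mapHomologicalComplex _

/-- `M ⊗_R R ≅ M` for complexes. -/
def extendId (f : R ⟶ R) (e : f = 𝟙 R) (M : DGMod R) : (extend f).obj M ≅ M :=
  HomologicalComplex.Hom.isoOfComponents (fun n => extIdIso f.hom (hom_eq_id e) (M.X n))
    (fun _ _ _ => (extIdIso_naturality f.hom (hom_eq_id e) _).symm)

/-- `M ⊗_R T ≅ (M ⊗_R S) ⊗_S T` for complexes. -/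
def extendComp (f : R ⟶ S) (g : S ⟶ T) (h : R ⟶ T) (e : f ≫ g = h) (M : DGMod R) :
    (extend h).obj M ≅ (extend g).obj ((extend f).obj M) :=
  HomologicalComplex.Hom.isoOfComponents (fun n => extCompIso f.hom g.hom h.hom (hom_comp_eq e) (M.X n))
    (fun _ _ _ => (extCompIso_naturality f.hom g.hom h.hom (hom_comp_eq e) _).symm)

lemma extendComp_naturality (f : R ⟶ S) (g : S ⟶ T) (h : R ⟶ T) (e : f ≫ g = h)
    {M M' : DGMod R} (a : M ⟶ M') :
    (extend h).map a ≫ (extendComp f g h e M').hom =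
      (extendComp f g h e M).hom ≫ (extend g).map ((extend f).map a) := by
  ext1 n
  exact extCompIso_naturality f.hom g.hom h.hom (hom_comp_eq e) (a.f n)

lemma extendComp_id (f : R ⟶ R) (g : R ⟶ S) (e : f = 𝟙 R) (e' : f ≫ g = g) (M : DGMod R) :
    (extendComp f g g e' M).hom ≫ (extend g).map (extendId f e M).hom = 𝟙 _ := by
  ext1 n
  exact extCompIso_id f.hom g.hom (hom_eq_id e) (hom_comp_eq e') (M.X n)

lemma extendComp_assoc (f : R ⟶ S) (g : S ⟶ T) (k : T ⟶ T') (fg : R ⟶ T) (gk : S ⟶ T')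
    (fgk : R ⟶ T') (e₁ : f ≫ g = fg) (e₂ : g ≫ k = gk) (e₃ : fg ≫ k = fgk) (e₄ : f ≫ gk = fgk)
    (M : DGMod R) :
    (extendComp fg k fgk e₃ M).hom ≫ (extend k).map (extendComp f g fg e₁ M).hom =
      (extendComp f gk fgk e₄ M).hom ≫ (extendComp g k gk e₂ ((extend f).obj M)).hom := by
  ext1 n
  exact extCompIso_assoc f.hom g.hom k.hom fg.hom gk.hom fgk.hom (hom_comp_eq e₁) (hom_comp_eq e₂)
    (hom_comp_eq e₃) (hom_comp_eq e₄) (M.X n)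

lemma extendComp_comp (f : R ⟶ S) (g : S ⟶ T) (k : T ⟶ T') (fg : R ⟶ T) (gk : S ⟶ T')
    (fgk : R ⟶ T') (e₁ : f ≫ g = fg) (e₂ : g ≫ k = gk) (e₃ : fg ≫ k = fgk) (e₄ : f ≫ gk = fgk)
    {M : DGMod R} {M' : DGMod S} {M'' : DGMod T} (a : (extend f).obj M ⟶ M')
    (b : (extend g).obj M' ⟶ M'') :
    (extendComp fg k fgk e₃ M).hom ≫
      (extend k).map ((extendComp f g fg e₁ M).hom ≫ (extend g).map a ≫ b) =
    ((extendComp f gk fgk e₄ M).hom ≫ (extend gk).map a) ≫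
      (extendComp g k gk e₂ M').hom ≫ (extend k).map b := by
  rw [Functor.map_comp, Functor.map_comp, ← Category.assoc,
    extendComp_assoc f g k fg gk fgk e₁ e₂ e₃ e₄ M]
  simp only [Category.assoc]
  rw [← Category.assoc ((extend gk).map a), extendComp_naturality, Category.assoc]

end Complexes

/-- The property that a morphism of DG-modules is surjective in each degree: the fibrations of
the projective model structure. -/
def fib (R : CommRingCat.{u}) : MorphismProperty (DGMod R) :=
  fun _ _ p => ∀ n : ℤ, Function.Surjective (p.f n)

/-- The cofibrations of the projective model structure on DG-modules: the morphisms with the left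
lifting property with respect to all degreewise surjective quasi-isomorphisms. -/
def cof (R : CommRingCat.{u}) : MorphismProperty (DGMod R) :=
  (fib R ⊓ HomologicalComplex.quasiIso (ModuleCat.{u} R) (ComplexShape.up ℤ)).llp

end DGMod

/-- A module over a diagram `A` of commutative rings indexed by a category `N`: a DG-module
`F_α` over `A_α` for each `α`, and `A_β`-linear morphisms of complexes
`f_{αβ} : F_α ⊗_{A_α} A_β ⟶ F_β`, normalised for identities and satisfying the cocycle condition
`f_{βγ} ∘ (f_{αβ} ⊗ A_γ) = f_{αγ}`. -/
structure DiagMod {N : Type u} [SmallCategory N] (A : N ⥤ CommRingCat.{u}) where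
  obj (α : N) : DGMod (A.obj α)
  map {α β : N} (s : α ⟶ β) : (DGMod.extend (A.map s)).obj (obj α) ⟶ obj β
  map_id (α : N) : map (𝟙 α) = (DGMod.extendId (A.map (𝟙 α)) (A.map_id α) (obj α)).hom
  map_comp {α β γ : N} (s : α ⟶ β) (t : β ⟶ γ) :
    map (s ≫ t) =
      (DGMod.extendComp (A.map s) (A.map t) (A.map (s ≫ t)) (A.map_comp s t).symm
        (obj α)).hom ≫ (DGMod.extend (A.map t)).map (map s) ≫ map t

namespace DiagMod

section

variable {N : Type u} [SmallCategory N] {A : N ⥤ CommRingCat.{u}}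

/-- A morphism of modules over a diagram of rings: morphisms `φ_α` of DG-modules over `A_α` with
`g_{αβ} ∘ (φ_α ⊗ A_β) = φ_β ∘ f_{αβ}`. -/
@[ext]
structure Hom (F G : DiagMod A) where
  app (α : N) : F.obj α ⟶ G.obj α
  naturality {α β : N} (s : α ⟶ β) :
    (DGMod.extend (A.map s)).map (app α) ≫ G.map s = F.map s ≫ app β

instance : Category (DiagMod A) where
  Hom := Hom
  id F := { app := fun α => 𝟙 (F.obj α), naturality := by simp }
  comp φ ψ :=
    { app := fun α => φ.app α ≫ ψ.app α
      naturality := fun s => by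
        rw [Functor.map_comp, Category.assoc, ψ.naturality, ← Category.assoc, φ.naturality,
          Category.assoc] }
  id_comp φ := Hom.ext (by funext α; exact Category.id_comp _)
  comp_id φ := Hom.ext (by funext α; exact Category.comp_id _)
  assoc φ ψ χ := Hom.ext (by funext α; exact Category.assoc _ _ _)

end

/-! ### Latching objects, for a diagram of rings indexed by a partially ordered set -/

section

variable {N : Type u} [PartialOrder N] {A : N ⥤ CommRingCat.{u}}

lemma map_homOfLE_comp (A : N ⥤ CommRingCat.{u}) {γ δ ε : N} (h₁ : γ ≤ δ) (h₂ : δ ≤ ε) :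
    A.map (homOfLE h₁) ≫ A.map (homOfLE h₂) = A.map (homOfLE (h₁.trans h₂)) :=
  (A.map_comp (homOfLE h₁) (homOfLE h₂)).symm

lemma map_homOfLE_trans (F : DiagMod A) {γ δ ε : N} (h₁ : γ ≤ δ) (h₂ : δ ≤ ε) :
    F.map (homOfLE (h₁.trans h₂)) =
      (DGMod.extendComp _ _ _ (map_homOfLE_comp A h₁ h₂) (F.obj γ)).hom ≫
        (DGMod.extend (A.map (homOfLE h₂))).map (F.map (homOfLE h₁)) ≫ F.map (homOfLE h₂) :=
  F.map_comp (homOfLE h₁) (homOfLE h₂)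

lemma map_homOfLE_refl (F : DiagMod A) (γ : N) :
    F.map (homOfLE (le_refl γ)) = (DGMod.extendId _ (A.map_id γ) (F.obj γ)).hom :=
  F.map_id γ

/-- For `γ ≤ δ ≤ α`, the map `F_γ ⊗ A_α ≅ (F_γ ⊗ A_δ) ⊗ A_α ⟶ F_δ ⊗ A_α` given by
`f_{γδ} ⊗ A_α`. -/
def latchingTransition (F : DiagMod A) {γ δ α : N} (h₁ : γ ≤ δ) (h₂ : δ ≤ α) :
    (DGMod.extend (A.map (homOfLE (h₁.trans h₂)))).obj (F.obj γ) ⟶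
      (DGMod.extend (A.map (homOfLE h₂))).obj (F.obj δ) :=
  (DGMod.extendComp _ _ _ (map_homOfLE_comp A h₁ h₂) (F.obj γ)).hom ≫
    (DGMod.extend (A.map (homOfLE h₂))).map (F.map (homOfLE h₁))

lemma latchingTransition_refl (F : DiagMod A) {γ α : N} (h : γ ≤ α) :
    F.latchingTransition (le_refl γ) h = 𝟙 _ := by
  rw [latchingTransition, map_homOfLE_refl]
  exact DGMod.extendComp_id _ _ _ _ _

lemma latchingTransition_trans (F : DiagMod A) {γ δ ε α : N} (h₁ : γ ≤ δ) (h₂ : δ ≤ ε)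
    (h₃ : ε ≤ α) :
    F.latchingTransition (h₁.trans h₂) h₃ =
      F.latchingTransition h₁ (h₂.trans h₃) ≫ F.latchingTransition h₂ h₃ := by
  rw [latchingTransition, map_homOfLE_trans F h₁ h₂]
  exact DGMod.extendComp_comp _ _ _ _ _ _ _ _ _ _ _ _

lemma latchingTransition_map (F : DiagMod A) {γ δ α : N} (h₁ : γ ≤ δ) (h₂ : δ ≤ α) :
    F.latchingTransition h₁ h₂ ≫ F.map (homOfLE h₂) = F.map (homOfLE (h₁.trans h₂)) := by
  rw [map_homOfLE_trans F h₁ h₂, latchingTransition, Category.assoc]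

lemma latchingTransition_naturality {F G : DiagMod A} (φ : F ⟶ G) {γ δ α : N} (h₁ : γ ≤ δ)
    (h₂ : δ ≤ α) :
    F.latchingTransition h₁ h₂ ≫ (DGMod.extend (A.map (homOfLE h₂))).map (φ.app δ) =
      (DGMod.extend (A.map (homOfLE (h₁.trans h₂)))).map (φ.app γ) ≫
        G.latchingTransition h₁ h₂ := by
  rw [latchingTransition, latchingTransition, Category.assoc, ← Functor.map_comp,
    ← φ.naturality, Functor.map_comp, ← Category.assoc, ← DGMod.extendComp_naturality,
    Category.assoc]

/-- The diagram `γ ↦ F_γ ⊗_{A_γ} A_α` of DG-modules over `A_α`, indexed by the `γ < α`. -/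
def latchingDiagram (F : DiagMod A) (α : N) : {γ : N // γ < α} ⥤ DGMod (A.obj α) where
  obj γ := (DGMod.extend (A.map (homOfLE γ.2.le))).obj (F.obj γ)
  map {γ δ} s := F.latchingTransition (leOfHom s : γ.1 ≤ δ.1) δ.2.le
  map_id γ := F.latchingTransition_refl γ.2.le
  map_comp {γ δ ε} s t :=
    F.latchingTransition_trans (leOfHom s : γ.1 ≤ δ.1) (leOfHom t : δ.1 ≤ ε.1) ε.2.le

/-- The latching module `L_α F = colim_{γ < α} F_γ ⊗_{A_γ} A_α`. -/
def latching (F : DiagMod A) (α : N) : DGMod (A.obj α) := colimit (F.latchingDiagram α)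

/-- The natural map `L_α F ⟶ F_α`, given by `f_{γα}` on `F_γ ⊗_{A_γ} A_α`. -/
def latchingMap (F : DiagMod A) (α : N) : F.latching α ⟶ F.obj α :=
  colimit.desc (F.latchingDiagram α)
    { pt := F.obj α
      ι :=
        { app := fun γ => F.map (homOfLE γ.2.le)
          naturality := fun γ δ s =>
            (F.latchingTransition_map (leOfHom s : γ.1 ≤ δ.1) δ.2.le).trans
              (Category.comp_id _).symm } }

/-- The map `L_α φ : L_α F ⟶ L_α G`, given by `φ_γ ⊗ A_α` on `F_γ ⊗_{A_γ} A_α`. -/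
def mapLatching {F G : DiagMod A} (φ : F ⟶ G) (α : N) : F.latching α ⟶ G.latching α :=
  colimMap
    { app := fun γ => (DGMod.extend (A.map (homOfLE γ.2.le))).map (φ.app γ)
      naturality := fun γ δ s =>
        latchingTransition_naturality φ (leOfHom s : γ.1 ≤ δ.1) δ.2.le }

lemma latchingMap_naturality {F G : DiagMod A} (φ : F ⟶ G) (α : N) :
    mapLatching φ α ≫ G.latchingMap α = F.latchingMap α ≫ φ.app α := by
  apply colimit.hom_ext
  intro γ
  have h := φ.naturality (homOfLE γ.2.le)
  dsimp only [mapLatching, latchingMap]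
  erw [ι_colimMap_assoc, colimit.ι_desc, colimit.ι_desc_assoc]
  exact h

/-- The relative latching map `L_α G ⊔_{L_α F} F_α ⟶ G_α`. -/
def relLatchingMap {F G : DiagMod A} (φ : F ⟶ G) (α : N) :
    pushout (mapLatching φ α) (F.latchingMap α) ⟶ G.obj α :=
  pushout.desc (G.latchingMap α) (φ.app α) (latchingMap_naturality φ α)

end

end DiagMod

/-- The nerve of a family of open subsets: the finite nonempty sets of indices such that the
intersection of the corresponding open subsets is nonempty, ordered by inclusion. -/
abbrev CoverNerve {X : Scheme.{u}} {H : Type u} (U : H → X.Opens) : Type u :=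
  {α : Finset H // α.Nonempty ∧ ((α.inf U : X.Opens) : Set X).Nonempty}

/-- The diagram of rings `α ↦ A_α = Γ(U_α, 𝒪_X)` over the nerve, where `U_α` is the intersection
of the `U h` for `h ∈ α`; the transition maps are the restriction maps. -/
def coverDiagram {X : Scheme.{u}} {H : Type u} (U : H → X.Opens) :
    CoverNerve U ⥤ CommRingCat.{u} where
  obj α := X.presheaf.obj (.op (α.1.inf U))
  map {α β} s := X.presheaf.map (homOfLE (Finset.inf_mono (leOfHom s : α.1 ≤ β.1))).op
  map_id α := X.presheaf.map_id _
  map_comp {α β γ} s t := by rw [← X.presheaf.map_comp]; rfl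

end

/-!
A module `F` over a diagram of rings amounts to the complexes `F_α` with semilinear restriction
maps, hence to a complex of presheaves of modules; this gives all limits and colimits.

The module `freeDisk A α n` represents `F ↦ F_α^n` and the cokernel `sphere A α n` of its
differential represents the `n`-cocycles of `F_α`. Lifting against `⊥ ⟶ disk` characterises the
indexwise surjections, and lifting against `sphere ⟶ disk` the indexwise surjective
quasi-isomorphisms, so that the small object argument yields both functorial factorizations.
Everything in `fib.llp` is a weak equivalence: a surjection `D ⟶ G` from a contractible `D` can be
used to factor `φ : F ⟶ G` as a homotopy equivalence `F ⟶ F ⊞ D` followed by a fibration, and `φ` is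
a retract of the former.

If all relative latching maps are cofibrations, lifts are built by well-founded induction on the
index. Conversely, `F ↦ (L_α F ⟶ F_α)` has a right adjoint `cofree`, and a trivial fibration
`p : M ⟶ M'` over `A_α` induces a trivial fibration `cofree (𝟙 M) ⟶ cofree p`; lifting `φ` against
it is the same as lifting the relative latching map of `φ` against `p`.
-/

noncomputable section

/-! ### Semilinear restriction maps -/

namespace DGMod

section Extension

variable {R S T : CommRingCat.{u}}

/-- The map `x ↦ 1 ⊗ x` from a complex to its extension of scalars. -/
def unit (f : R ⟶ S) (M : DGMod R) (n : ℤ) : M.X n →ₛₗ[f.hom] ((extend f).obj M).X n where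
  toFun x := (ModuleCat.extendRestrictScalarsAdj.{u, u, u} f.hom).unit.app (M.X n) x
  map_add' := map_add ((ModuleCat.extendRestrictScalarsAdj.{u, u, u} f.hom).unit.app (M.X n)).hom
  map_smul' := map_smul ((ModuleCat.extendRestrictScalarsAdj.{u, u, u} f.hom).unit.app (M.X n)).hom

lemma extend_hom_ext (f : R ⟶ S) {M : DGMod R} {K : DGMod S} {a b : (extend f).obj M ⟶ K}
    (h : ∀ n x, a.f n (unit f M n x) = b.f n (unit f M n x)) : a = b := by
  ext1 n
  apply ((ModuleCat.extendRestrictScalarsAdj.{u, u, u} f.hom).homEquiv _ _).injective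
  ext x
  exact h n x

lemma extend_map_unit (f : R ⟶ S) {M M' : DGMod R} (a : M ⟶ M') (n : ℤ) (x : M.X n) :
    ((extend f).map a).f n (unit f M n x) = unit f M' n (a.f n x) :=
  congr($((ModuleCat.extendRestrictScalarsAdj.{u, u, u} f.hom).unit.naturality (a.f n)) x).symm

lemma extend_d_unit (f : R ⟶ S) (M : DGMod R) (i j : ℤ) (x : M.X i) :
    ((extend f).obj M).d i j (unit f M i x) = unit f M j (M.d i j x) :=
  congr($((ModuleCat.extendRestrictScalarsAdj.{u, u, u} f.hom).unit.naturality (M.d i j)) x).symm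

lemma extendId_unit (f : R ⟶ R) (e : f = 𝟙 R) (M : DGMod R) (n : ℤ) (x : M.X n) :
    (extendId f e M).hom.f n (unit f M n x) = x := by
  subst e
  exact ModuleCat.extendScalarsId_hom_app_one_tmul _ _

lemma extendComp_unit (f : R ⟶ S) (g : S ⟶ T) (h : R ⟶ T) (e : f ≫ g = h) (M : DGMod R) (n : ℤ)
    (x : M.X n) :
    (extendComp f g h e M).hom.f n (unit h M n x) = unit g _ n (unit f M n x) := by
  subst e
  exact ModuleCat.extendScalarsComp_hom_app_one_tmul _ _ _ _

/-- The linear map `M ⊗_R S ⟶ K` induced by a semilinear map `M → K`. -/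
def ext₀Desc (f : R ⟶ S) {M : ModuleCat.{u} R} {K : ModuleCat.{u} S} (g : M →ₛₗ[f.hom] K) :
    (ext₀ f.hom).obj M ⟶ K :=
  ((ModuleCat.extendRestrictScalarsAdj.{u, u, u} f.hom).homEquiv _ _).symm
    (ModuleCat.ofHom (Y := (ModuleCat.restrictScalars f.hom).obj K)
      { toFun := g, map_add' := map_add g, map_smul' := g.map_smulₛₗ })

lemma ext₀Desc_unit (f : R ⟶ S) {M : ModuleCat.{u} R} {K : ModuleCat.{u} S}
    (g : M →ₛₗ[f.hom] K) (x : M) :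
    ext₀Desc f g ((ModuleCat.extendRestrictScalarsAdj.{u, u, u} f.hom).unit.app M x) = g x :=
  congr($(((ModuleCat.extendRestrictScalarsAdj.{u, u, u} f.hom).homEquiv _ _).apply_symm_apply
    (ModuleCat.ofHom (Y := (ModuleCat.restrictScalars f.hom).obj K)
      { toFun := g, map_add' := map_add g, map_smul' := g.map_smulₛₗ })) x)

/-- The morphism of complexes `M ⊗_R S ⟶ K` induced by semilinear maps `M^n → K^n` which commute
with the differentials. -/
def extendDesc (f : R ⟶ S) {M : DGMod R} {K : DGMod S} (g : ∀ n, M.X n →ₛₗ[f.hom] K.X n)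
    (hg : ∀ n x, K.d n (n + 1) (g n x) = g (n + 1) (M.d n (n + 1) x)) : (extend f).obj M ⟶ K where
  f n := ext₀Desc f (g n)
  comm' i j hij := by
    obtain rfl : i + 1 = j := hij
    apply ((ModuleCat.extendRestrictScalarsAdj.{u, u, u} f.hom).homEquiv _ _).injective
    ext x
    calc K.d i (i + 1) (ext₀Desc f (g i) (unit f M i x))
        = K.d i (i + 1) (g i x) := congrArg _ (ext₀Desc_unit f (g i) x)
      _ = g (i + 1) (M.d i (i + 1) x) := hg i x
      _ = ext₀Desc f (g (i + 1)) (unit f M (i + 1) (M.d i (i + 1) x)) :=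
        (ext₀Desc_unit f (g (i + 1)) _).symm
      _ = ext₀Desc f (g (i + 1)) (((extend f).obj M).d i (i + 1) (unit f M i x)) := by
        rw [extend_d_unit]

lemma extendDesc_unit (f : R ⟶ S) {M : DGMod R} {K : DGMod S} (g : ∀ n, M.X n →ₛₗ[f.hom] K.X n)
    (hg : ∀ n x, K.d n (n + 1) (g n x) = g (n + 1) (M.d n (n + 1) x)) (n : ℤ) (x : M.X n) :
    (extendDesc f g hg).f n (unit f M n x) = g n x :=
  ext₀Desc_unit f (g n) x

end Extension

end DGMod

namespace DiagMod

section Restriction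

variable {N : Type u} [SmallCategory N] {A : N ⥤ CommRingCat.{u}}

/-- The semilinear restriction maps `F_α → F_β` of a module over a diagram of rings, adjoint to
`f_{αβ} : F_α ⊗ A_β ⟶ F_β`. -/
def res (F : DiagMod A) {α β : N} (s : α ⟶ β) (n : ℤ) :
    (F.obj α).X n →ₛₗ[(A.map s).hom] (F.obj β).X n where
  toFun x := (F.map s).f n (DGMod.unit _ _ n x)
  map_add' x y := by rw [map_add, map_add]
  map_smul' r x := by rw [LinearMap.map_smulₛₗ]; exact map_smul ((F.map s).f n).hom _ _

lemma res_apply (F : DiagMod A) {α β : N} (s : α ⟶ β) (n : ℤ) (x : (F.obj α).X n) :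
    F.res s n x = (F.map s).f n (DGMod.unit _ _ n x) := rfl

lemma res_id (F : DiagMod A) (α : N) (n : ℤ) (x : (F.obj α).X n) : F.res (𝟙 α) n x = x := by
  rw [res_apply, F.map_id]
  exact DGMod.extendId_unit _ _ _ _ _

lemma res_comp (F : DiagMod A) {α β γ : N} (s : α ⟶ β) (t : β ⟶ γ) (n : ℤ) (x : (F.obj α).X n) :
    F.res (s ≫ t) n x = F.res t n (F.res s n x) := by
  simp only [res_apply, F.map_comp, HomologicalComplex.comp_f, ModuleCat.comp_apply,
    DGMod.extendComp_unit, DGMod.extend_map_unit]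

lemma d_res (F : DiagMod A) {α β : N} (s : α ⟶ β) (i j : ℤ) (x : (F.obj α).X i) :
    (F.obj β).d i j (F.res s i x) = F.res s j ((F.obj α).d i j x) := by
  simp only [res_apply, ← DGMod.extend_d_unit]
  exact congr($((F.map s).comm i j) _)

lemma app_res {F G : DiagMod A} (φ : F ⟶ G) {α β : N} (s : α ⟶ β) (n : ℤ) (x : (F.obj α).X n) :
    (φ.app β).f n (F.res s n x) = G.res s n ((φ.app α).f n x) := by
  simp only [res_apply, ← DGMod.extend_map_unit]
  exact congr(($(φ.naturality s)).f n (DGMod.unit _ _ n x)).symm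

/-- The module over a diagram of rings with given semilinear restriction maps. -/
def ofRes (obj : ∀ α, DGMod (A.obj α))
    (res : ∀ {α β : N} (s : α ⟶ β) (n : ℤ), (obj α).X n →ₛₗ[(A.map s).hom] (obj β).X n)
    (d_res : ∀ {α β : N} (s : α ⟶ β) (n : ℤ) x,
      (obj β).d n (n + 1) (res s n x) = res s (n + 1) ((obj α).d n (n + 1) x))
    (res_id : ∀ (α : N) n x, res (𝟙 α) n x = x)
    (res_comp : ∀ {α β γ : N} (s : α ⟶ β) (t : β ⟶ γ) n x,
      res (s ≫ t) n x = res t n (res s n x)) : DiagMod A where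
  obj := obj
  map s := DGMod.extendDesc _ (res s) (d_res s)
  map_id α := by
    apply DGMod.extend_hom_ext
    intro n x
    rw [DGMod.extendDesc_unit, DGMod.extendId_unit, res_id]
  map_comp s t := by
    apply DGMod.extend_hom_ext
    intro n x
    simp only [HomologicalComplex.comp_f, ModuleCat.comp_apply, DGMod.extendComp_unit,
      DGMod.extend_map_unit, DGMod.extendDesc_unit, res_comp]

lemma ofRes_res (obj : ∀ α, DGMod (A.obj α)) (res d_res res_id res_comp) {α β : N} (s : α ⟶ β)
    (n : ℤ) (x : (obj α).X n) :
    (ofRes obj res d_res res_id res_comp).res s n x = res s n x :=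
  DGMod.extendDesc_unit _ (res s) (d_res s) _ _

/-- The morphism given by morphisms of complexes `F_α ⟶ G_α` which commute with the restriction
maps. -/
def homOfRes {F G : DiagMod A} (app : ∀ α, F.obj α ⟶ G.obj α)
    (h : ∀ {α β : N} (s : α ⟶ β) n x, (app β).f n (F.res s n x) = G.res s n ((app α).f n x)) :
    F ⟶ G where
  app := app
  naturality s := by
    apply DGMod.extend_hom_ext
    intro n x
    simp only [HomologicalComplex.comp_f, ModuleCat.comp_apply, DGMod.extend_map_unit]
    exact (h s n x).symm

@[ext]
lemma hom_ext {F G : DiagMod A} {φ ψ : F ⟶ G} (h : ∀ α, φ.app α = ψ.app α) : φ = ψ :=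
  Hom.ext (funext h)

@[simp]
lemma comp_app {F G H : DiagMod A} (φ : F ⟶ G) (ψ : G ⟶ H) (α : N) :
    (φ ≫ ψ).app α = φ.app α ≫ ψ.app α := rfl

/-- The functor `F ↦ F_α`. -/
def eval (A : N ⥤ CommRingCat.{u}) (α : N) : DiagMod A ⥤ DGMod (A.obj α) where
  obj F := F.obj α
  map φ := φ.app α

end Restriction

end DiagMod

/-! ### Limits, colimits and free disks -/

namespace DiagMod

section Presheaf

variable {N : Type u} [SmallCategory N] (A : N ⥤ CommRingCat.{u})

/-- The diagram of rings `A`, viewed as a presheaf of rings on `Nᵒᵖ`. -/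
abbrev ringPresheaf : (Nᵒᵖ)ᵒᵖ ⥤ RingCat.{u} :=
  unopUnop N ⋙ A ⋙ forget₂ CommRingCat RingCat

variable {A}

/-- The presheaf of modules `α ↦ (F_α)^n`. -/
@[simps]
def degree (F : DiagMod A) (n : ℤ) : PresheafOfModules.{u} (ringPresheaf A) where
  obj X := (F.obj X.unop.unop).X n
  map {X Y} s := ModuleCat.ofHom
    (Y := (ModuleCat.restrictScalars ((ringPresheaf A).map s).hom).obj
      ((F.obj Y.unop.unop).X n))
    { toFun := F.res s.unop.unop n
      map_add' := map_add _
      map_smul' := fun r x => (F.res s.unop.unop n).map_smulₛₗ r x }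
  map_id X := by
    ext x
    exact F.res_id _ n x
  map_comp s t := by
    ext x
    exact F.res_comp _ _ n x

variable (A) in
/-- Modules over a diagram of rings as complexes of presheaves of modules. -/
@[simps]
def toComplex : DiagMod A ⥤ CochainComplex (PresheafOfModules.{u} (ringPresheaf A)) ℤ where
  obj F :=
    { X := F.degree
      d i j :=
        { app X := (F.obj X.unop.unop).d i j
          naturality s := by
            ext x
            exact F.d_res s.unop.unop i j x }
      shape i j h := by
        ext X : 1
        exact (F.obj X.unop.unop).shape i j h
      d_comp_d' i j k _ _ := by
        ext X : 1
        exact (F.obj X.unop.unop).d_comp_d i j k }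
  map φ :=
    { f n :=
        { app X := (φ.app X.unop.unop).f n
          naturality s := by
            ext x
            exact app_res φ s.unop.unop n x }
      comm' i j _ := by
        ext X : 1
        exact (φ.app X.unop.unop).comm i j }

instance : (toComplex A).Faithful where
  map_injective {_ _ _ _} h := by
    ext α n : 2
    exact congr(PresheafOfModules.Hom.app (HomologicalComplex.Hom.f $h n) (.op (.op α)))

instance : (toComplex A).Full where
  map_surjective g :=
    ⟨homOfRes
      (fun α =>
        { f n := (g.f n).app (.op (.op α))
          comm' i j _ := congr(PresheafOfModules.Hom.app $(g.comm i j) (.op (.op α))) })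
      (fun s n x => PresheafOfModules.naturality_apply (g.f n) s.op.op x), rfl⟩

/-- The module over a diagram of rings underlying a complex of presheaves of modules. -/
def ofComplex (K : CochainComplex (PresheafOfModules.{u} (ringPresheaf A)) ℤ) : DiagMod A :=
  ofRes
    (fun α => ((PresheafOfModules.evaluation (ringPresheaf A)
      (.op (.op α))).mapHomologicalComplex _).obj K)
    (fun s n => (K.X n).restrictₛₗ s.op.op)
    (fun s n x => PresheafOfModules.naturality_apply (K.d n (n + 1)) s.op.op x)
    (fun α n x => congr($((K.X n).map_id (.op (.op α))) x))
    (fun s t n x => (K.X n).map_comp_apply s.op.op t.op.op x)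

instance : (toComplex A).EssSurj where
  mem_essImage K :=
    ⟨ofComplex K, ⟨HomologicalComplex.Hom.isoOfComponents
      (fun n => PresheafOfModules.isoMk (fun _ => Iso.refl _) (fun X Y s => by
        ext x
        have : (ofComplex K).res s.unop.unop n x = (K.X n).map s x := ofRes_res _ _ _ _ _ _ _ _
        exact this))
      (fun i j _ => by
        ext X : 1
        exact (Category.id_comp _).trans (Category.comp_id _).symm)⟩⟩

instance : (toComplex A).IsEquivalence where

instance : HasLimits (DiagMod A) where
  has_limits_of_shape _ := Adjunction.hasLimitsOfShape_of_equivalence (toComplex A)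

instance : HasColimits (DiagMod A) where
  has_colimits_of_shape _ := Adjunction.hasColimitsOfShape_of_equivalence (toComplex A)

end Presheaf

section FreeDisk

variable {N : Type u} [SmallCategory N] (A : N ⥤ CommRingCat.{u}) (α : N) (n : ℤ)

/-- The functor `F ↦ (F_α)^n` on modules over a diagram of rings. -/
abbrev elements : DiagMod A ⥤ Type u :=
  eval A α ⋙ HomologicalComplex.eval _ _ n ⋙ forget (ModuleCat.{u} (A.obj α))

instance (J : Type u) [SmallCategory J] [IsFiltered J] :
    PreservesColimitsOfShape J (elements A α n) :=
  inferInstanceAs (PreservesColimitsOfShape J (toComplex A ⋙ HomologicalComplex.eval _ _ n ⋙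
    PresheafOfModules.evaluation (ringPresheaf A) (.op (.op α)) ⋙ forget _))

instance : (elements A α n).IsCorepresentable where
  has_corepresentation :=
    let P := (PresheafOfModules.free (ringPresheaf A)).obj (yoneda.obj (.op α))
    let adj := (toComplex A).asEquivalence.symm.toAdjunction
    let disk := HomologicalComplex.evalCompCoyonedaCorepresentable (.up ℤ) P n
    ⟨_, ⟨{
      homEquiv := (adj.homEquiv _ _).trans (disk.homEquiv.trans PresheafOfModules.freeYonedaEquiv)
      homEquiv_comp g f := congrArg PresheafOfModules.freeYonedaEquiv
        ((congrArg disk.homEquiv (adj.homEquiv_naturality_right f g)).trans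
          (disk.homEquiv_comp ((toComplex A).map g) (adj.homEquiv _ _ f))) }⟩⟩

/-- The contractible complex of modules freely generated by an element of degree `n` over `α`. -/
def freeDisk : DiagMod A := (elements A α n).coreprX

/-- The universal element of the free disk. -/
def freeDiskGen : ((freeDisk A α n).obj α).X n := (elements A α n).coreprx

variable {A α n}

/-- The morphism out of a free disk given by an element. -/
def freeDiskDesc {F : DiagMod A} (x : (F.obj α).X n) : freeDisk A α n ⟶ F :=
  (elements A α n).corepresentableBy.homEquiv.symm x

lemma corepresentableBy_homEquiv {F : DiagMod A} (φ : freeDisk A α n ⟶ F) :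
    (elements A α n).corepresentableBy.homEquiv φ = (φ.app α).f n (freeDiskGen A α n) :=
  Functor.CorepresentableBy.homEquiv_eq _ φ

@[simp]
lemma freeDiskDesc_gen {F : DiagMod A} (x : (F.obj α).X n) :
    ((freeDiskDesc x).app α).f n (freeDiskGen A α n) = x :=
  (corepresentableBy_homEquiv _).symm.trans (Equiv.apply_symm_apply _ x)

@[ext]
lemma freeDisk_hom_ext {F : DiagMod A} {φ ψ : freeDisk A α n ⟶ F}
    (h : (φ.app α).f n (freeDiskGen A α n) = (ψ.app α).f n (freeDiskGen A α n)) : φ = ψ :=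
  (elements A α n).corepresentableBy.homEquiv.injective
    ((corepresentableBy_homEquiv φ).trans (h.trans (corepresentableBy_homEquiv ψ).symm))

end FreeDisk

end DiagMod

/-! ### Morphisms with the left lifting property with respect to fibrations -/

section Contractible

open CochainComplex

variable {C : Type*} [Category* C] [Preadditive C] [HasBinaryBiproducts C]

lemma exists_contractible_splitEpi_shift (K : CochainComplex C ℤ) :
    ∃ (D : CochainComplex C ℤ) (π : D ⟶ K⟦(1 : ℤ)⟧),
      Nonempty (Homotopy (𝟙 D) 0) ∧ ∀ n, IsSplitEpi (π.f n) := by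
  let δ : mappingCone (𝟙 K) ⟶ K⟦(1 : ℤ)⟧ := (mappingCone.triangle (𝟙 K)).mor₃
  have hδ (n : ℤ) : (mappingCone.inl (𝟙 K)).v (n + 1) n (by lia) ≫ δ.f n =
      -(K.shiftFunctorObjXIso 1 n (n + 1) rfl).inv :=
    mappingCone.inl_v_triangle_mor₃_f (𝟙 K) (n + 1) n (by lia)
  refine ⟨mappingCone (𝟙 K), δ, ⟨mappingCone.homotopyToZeroOfId K⟩, fun n => .mk'
    ⟨-(K.shiftFunctorObjXIso 1 n (n + 1) rfl).hom ≫ (mappingCone.inl (𝟙 K)).v (n + 1) n (by lia),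
      ?_⟩⟩
  rw [Preadditive.neg_comp, Category.assoc, hδ, Preadditive.comp_neg, neg_neg]
  exact Iso.hom_inv_id _

lemma exists_contractible_splitEpi (K : CochainComplex C ℤ) :
    ∃ (D : CochainComplex C ℤ) (π : D ⟶ K),
      Nonempty (Homotopy (𝟙 D) 0) ∧ ∀ n, IsSplitEpi (π.f n) := by
  obtain ⟨D, π, hD, hπ⟩ := exists_contractible_splitEpi_shift (K⟦(-1 : ℤ)⟧)
  let e := shiftNegShift K (1 : ℤ)
  refine ⟨D, π ≫ e.hom, hD, fun n => ?_⟩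
  have := hπ n
  rw [HomologicalComplex.comp_f]
  infer_instance

/-- A section of `(i, π) : K ⊞ D ⟶ L` under `K` exhibits `i` as a homotopy equivalence, if `D` is
contractible. -/
def homotopyEquivOfSection {K L D : CochainComplex C ℤ} (i : K ⟶ L) (π : D ⟶ L)
    (hD : Homotopy (𝟙 D) 0) (s : L ⟶ K ⊞ D) (hi : i ≫ s = biprod.inl)
    (hs : s ≫ biprod.desc i π = 𝟙 L) : HomotopyEquiv K L where
  hom := i
  inv := s ≫ biprod.fst
  homotopyHomInvId := .ofEq (by rw [reassoc_of% hi, biprod.inl_fst])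
  homotopyInvHomId :=
    have h : 𝟙 L = (s ≫ biprod.fst) ≫ i + (s ≫ biprod.snd) ≫ 𝟙 D ≫ π := by
      rw [← hs, biprod.desc_eq, Preadditive.comp_add, Category.id_comp, Category.assoc,
        Category.assoc]
    .symm <| (Homotopy.ofEq h).trans <| ((Homotopy.refl _).add
      ((hD.compRight π).compLeft (s ≫ biprod.snd))).trans (.ofEq (by simp))

end Contractible

namespace DiagMod

variable {N : Type u} [SmallCategory N] {A : N ⥤ CommRingCat.{u}}

/-- The morphisms which are degreewise surjective at each object of the diagram. -/
def fib (A : N ⥤ CommRingCat.{u}) : MorphismProperty (DiagMod A) :=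
  fun _ _ p => ∀ α, DGMod.fib _ (p.app α)

/-- The morphisms which are quasi-isomorphisms at each object of the diagram. -/
def weq (A : N ⥤ CommRingCat.{u}) : MorphismProperty (DiagMod A) :=
  fun _ _ φ => ∀ α, QuasiIso (φ.app α)

lemma fib_of_isSplitEpi_toComplex_map {F G : DiagMod A} (p : F ⟶ G)
    (hp : ∀ n, IsSplitEpi (((toComplex A).map p).f n)) : fib A p := fun α n =>
  have := hp n
  (ModuleCat.epi_iff_surjective ((p.app α).f n)).1 (inferInstanceAs
    (Epi ((PresheafOfModules.evaluation (ringPresheaf A) (.op (.op α))).map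
      (((toComplex A).map p).f n))))

lemma weq_of_homotopyEquiv {F G : DiagMod A} (φ : F ⟶ G)
    (e : HomotopyEquiv ((toComplex A).obj F) ((toComplex A).obj G))
    (he : e.hom = (toComplex A).map φ) : weq A φ := fun α => by
  let ev := PresheafOfModules.evaluation (ringPresheaf A) (.op (.op α))
  have h : QuasiIso ((ev.mapHomologicalComplex (.up ℤ)).map e.hom) :=
    (ev.mapHomotopyEquiv e).quasiIso_hom
  rw [he] at h
  exact h

lemma llp_fib_le_weq : (fib A).llp ≤ weq A := fun F G φ hφ => by
  let E := toComplex A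
  obtain ⟨D, π, ⟨hD⟩, hπ⟩ := exists_contractible_splitEpi (E.obj G)
  let e := E.objObjPreimageIso (E.obj F ⊞ D)
  let q : E.objPreimage (E.obj F ⊞ D) ⟶ G := E.preimage (e.hom ≫ biprod.desc (E.map φ) π)
  have hq : fib A q := fib_of_isSplitEpi_toComplex_map q fun n => .mk'
    { section_ := section_ (π.f n) ≫ (biprod.inr ≫ e.inv).f n
      id := by
        rw [E.map_preimage, Category.assoc, ← HomologicalComplex.comp_f]
        simp }
  have := hφ q hq
  have sq : CommSq (E.preimage (biprod.inl ≫ e.inv)) φ q (𝟙 G) :=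
    ⟨E.map_injective (by simp [q])⟩
  refine weq_of_homotopyEquiv φ (homotopyEquivOfSection (E.map φ) π hD (E.map sq.lift ≫ e.hom)
    ?_ ?_) rfl
  · rw [← E.map_comp_assoc, sq.fac_left, E.map_preimage, Category.assoc, e.inv_hom_id,
      Category.comp_id]
  · rw [Category.assoc, ← E.map_preimage (e.hom ≫ _), ← E.map_comp, sq.fac_right, E.map_id]

end DiagMod

lemma quasiIso_g_iff_acyclic_X₁ {C : Type*} [Category* C] [Abelian C]
    {S : ShortComplex (CochainComplex C ℤ)} (hS : S.ShortExact) :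
    QuasiIso S.g ↔ S.X₁.Acyclic := by
  refine ⟨hS.acyclic_X₁, fun h => ⟨fun n => ?_⟩⟩
  have : Mono (HomologicalComplex.homologyMap S.g n) :=
    (hS.homology_exact₂ n).mono_g ((h n).isZero_homology.eq_of_src _ _)
  have : Epi (HomologicalComplex.homologyMap S.g n) :=
    (hS.homology_exact₃ n (n + 1) rfl).epi_f ((h (n + 1)).isZero_homology.eq_of_tgt _ _)
  rw [quasiIsoAt_iff_isIso_homologyMap]
  exact isIso_of_mono_of_epi _

namespace DGMod

variable {R : CommRingCat.{u}} {K L : DGMod R}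

lemma d_d_apply (K : DGMod R) (i j k : ℤ) (x : K.X i) : K.d j k (K.d i j x) = 0 :=
  congr($(K.d_comp_d i j k) x)

lemma d_f_apply (f : K ⟶ L) (i j : ℤ) (x : K.X i) : L.d i j (f.f i x) = f.f j (K.d i j x) :=
  congr($(f.comm i j) x)

lemma acyclic_iff (K : DGMod R) : K.Acyclic ↔
    ∀ (n : ℤ) (x : K.X (n + 1)), K.d (n + 1) (n + 1 + 1) x = 0 → ∃ y, K.d n (n + 1) y = x := by
  rw [HomologicalComplex.acyclic_iff, ← (Equiv.addRight (1 : ℤ)).forall_congr_right]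
  refine forall_congr' fun n => ?_
  rw [Equiv.coe_addRight, K.exactAt_iff' n (n + 1) (n + 1 + 1) (by simp) (by simp),
    ShortComplex.moduleCat_exact_iff]
  rfl

lemma epi_iff_fib (f : K ⟶ L) : Epi f ↔ fib R f := by
  refine ⟨fun _ n => (ModuleCat.epi_iff_surjective (f.f n)).1 inferInstance, fun h => ?_⟩
  have (n : ℤ) : Epi (f.f n) := (ModuleCat.epi_iff_surjective (f.f n)).2 (h n)
  exact HomologicalComplex.epi_of_epi_f f this

lemma mem_range_kernel_ι_iff (f : K ⟶ L) (n : ℤ) (x : K.X n) :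
    (∃ y, (kernel.ι f).f n y = x) ↔ f.f n x = 0 :=
  ⟨by rintro ⟨y, rfl⟩; exact congr(($(kernel.condition f)).f n y), fun h =>
    (ShortComplex.moduleCat_exact_iff _).1
      ((ShortComplex.exact_kernel f).map (HomologicalComplex.eval _ _ n)) x h⟩

lemma kernel_ι_injective (f : K ⟶ L) (n : ℤ) : Function.Injective ((kernel.ι f).f n) :=
  (ModuleCat.mono_iff_injective _).1 inferInstance

lemma quasiIso_iff_of_fib {f : K ⟶ L} (hf : fib R f) : QuasiIso f ↔
    ∀ (n : ℤ) (x : K.X (n + 1)), K.d (n + 1) (n + 1 + 1) x = 0 → f.f (n + 1) x = 0 →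
      ∃ z : K.X n, K.d n (n + 1) z = x ∧ f.f n z = 0 := by
  have hS : (ShortComplex.mk _ f (kernel.condition f)).ShortExact :=
    { exact := ShortComplex.exact_kernel f, epi_g := (epi_iff_fib f).2 hf }
  rw [quasiIso_g_iff_acyclic_X₁ hS, acyclic_iff]
  refine forall_congr' fun n => ⟨fun h x hx hfx => ?_, fun h y hy => ?_⟩
  · obtain ⟨y, rfl⟩ := (mem_range_kernel_ι_iff f _ x).2 hfx
    rw [d_f_apply, map_eq_zero_iff _ (kernel_ι_injective f _)] at hx
    obtain ⟨z, rfl⟩ := h y hx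
    exact ⟨(kernel.ι f).f n z, d_f_apply _ _ _ _, (mem_range_kernel_ι_iff f _ _).1 ⟨z, rfl⟩⟩
  · obtain ⟨_, hz, hfz⟩ := h ((kernel.ι f).f _ y) (by rw [d_f_apply, hy, map_zero])
      ((mem_range_kernel_ι_iff f _ _).1 ⟨y, rfl⟩)
    obtain ⟨z, rfl⟩ := (mem_range_kernel_ι_iff f _ _).2 hfz
    exact ⟨z, kernel_ι_injective f _ ((d_f_apply _ _ _ _).symm.trans hz)⟩

lemma fib_and_quasiIso_iff (f : K ⟶ L) : (fib R f ∧ QuasiIso f) ↔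
    ∀ (n : ℤ) (x : K.X (n + 1)) (y : L.X n), K.d (n + 1) (n + 1 + 1) x = 0 →
      L.d n (n + 1) y = f.f (n + 1) x → ∃ z : K.X n, K.d n (n + 1) z = x ∧ f.f n z = y := by
  refine ⟨fun ⟨hs, hf⟩ n x y hx hy => ?_, fun h => ?_⟩
  · obtain ⟨w, rfl⟩ := hs n y
    obtain ⟨v, hv, hfv⟩ := (quasiIso_iff_of_fib hs).1 hf n (x - K.d n (n + 1) w)
      (by rw [map_sub, hx, d_d_apply, sub_zero]) (by rw [map_sub, ← hy, d_f_apply, sub_self])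
    exact ⟨v + w, by rw [map_add, hv, sub_add_cancel], by rw [map_add, hfv, zero_add]⟩
  · have hs : fib R f := fun n y => by
      obtain ⟨x, hx, hx'⟩ := h (n + 1) 0 (L.d n (n + 1) y) (map_zero _)
        (by rw [d_d_apply, map_zero])
      obtain ⟨z, -, hz⟩ := h n x y hx hx'.symm
      exact ⟨z, hz⟩
    exact ⟨hs, (quasiIso_iff_of_fib hs).2 fun n x hx hfx => h n x 0 hx (by rw [hfx, map_zero])⟩

end DGMod

/-! ### Generating cofibrations -/

namespace DiagMod

section Sphere

variable {N : Type u} [SmallCategory N] {A : N ⥤ CommRingCat.{u}} {α : N} {n : ℤ}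

lemma comp_app_f_apply {F G H : DiagMod A} (φ : F ⟶ G) (ψ : G ⟶ H) (x : (F.obj α).X n) :
    ((φ ≫ ψ).app α).f n x = (ψ.app α).f n ((φ.app α).f n x) := rfl

lemma freeDiskDesc_comp {F G : DiagMod A} (x : (F.obj α).X n) (φ : F ⟶ G) :
    freeDiskDesc x ≫ φ = freeDiskDesc ((φ.app α).f n x) := by
  ext
  rw [comp_app_f_apply, freeDiskDesc_gen, freeDiskDesc_gen]

variable (A α n) in
/-- The module freely generated by a cycle of degree `n` over `α`. -/
def sphere : DiagMod A :=
  coequalizer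
    (freeDiskDesc (((freeDisk A α n).obj α).d n (n + 1) (freeDiskGen A α n)))
    (freeDiskDesc (0 : ((freeDisk A α n).obj α).X (n + 1)))

variable (A α n) in
/-- The quotient map which kills the differential of the generator. -/
def sphereπ : freeDisk A α n ⟶ sphere A α n := coequalizer.π _ _

variable (A α n) in
/-- The universal cycle of the sphere. -/
def sphereGen : ((sphere A α n).obj α).X n := ((sphereπ A α n).app α).f n (freeDiskGen A α n)

lemma d_sphereGen : ((sphere A α n).obj α).d n (n + 1) (sphereGen A α n) = 0 := by
  have h := coequalizer.condition
    (freeDiskDesc (((freeDisk A α n).obj α).d n (n + 1) (freeDiskGen A α n)))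
    (freeDiskDesc (0 : ((freeDisk A α n).obj α).X (n + 1)))
  have h' := congr(((Hom.app $h α).f (n + 1)) (freeDiskGen A α (n + 1)))
  rw [comp_app_f_apply, comp_app_f_apply, freeDiskDesc_gen, freeDiskDesc_gen, map_zero,
    ← DGMod.d_f_apply] at h'
  exact h'

@[ext]
lemma sphere_hom_ext {F : DiagMod A} {φ ψ : sphere A α n ⟶ F}
    (h : (φ.app α).f n (sphereGen A α n) = (ψ.app α).f n (sphereGen A α n)) : φ = ψ :=
  coequalizer.hom_ext (freeDisk_hom_ext h)

/-- The morphism out of a sphere given by a cycle. -/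
def sphereDesc {F : DiagMod A} (x : (F.obj α).X n) (hx : (F.obj α).d n (n + 1) x = 0) :
    sphere A α n ⟶ F :=
  coequalizer.desc (freeDiskDesc x) (by
    rw [freeDiskDesc_comp, freeDiskDesc_comp, map_zero, ← DGMod.d_f_apply, freeDiskDesc_gen, hx])

lemma sphereDesc_gen {F : DiagMod A} (x : (F.obj α).X n) (hx : (F.obj α).d n (n + 1) x = 0) :
    ((sphereDesc x hx).app α).f n (sphereGen A α n) = x := by
  have h : sphereπ A α n ≫ sphereDesc x hx = freeDiskDesc x := coequalizer.π_desc _ _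
  rw [sphereGen, ← comp_app_f_apply, h, freeDiskDesc_gen]

variable (A α n) in
/-- The inclusion of the boundary sphere, generated by a cycle of degree `n + 1`, in the free disk
generated by an element of degree `n`. -/
def sphereInclusion : sphere A α (n + 1) ⟶ freeDisk A α n :=
  sphereDesc (((freeDisk A α n).obj α).d n (n + 1) (freeDiskGen A α n))
    (DGMod.d_d_apply _ _ _ _ _)

lemma sphereInclusion_comp_gen {F : DiagMod A} (φ : freeDisk A α n ⟶ F) :
    ((sphereInclusion A α n ≫ φ).app α).f (n + 1) (sphereGen A α (n + 1)) =
      (F.obj α).d n (n + 1) ((φ.app α).f n (freeDiskGen A α n)) := by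
  rw [comp_app_f_apply, sphereInclusion, sphereDesc_gen, DGMod.d_f_apply]

end Sphere

section Lifting

variable {N : Type u} [SmallCategory N] {A : N ⥤ CommRingCat.{u}} {α : N} {n : ℤ}
  {F G : DiagMod A} {p : F ⟶ G}

lemma hasLiftingProperty_initial_to_freeDisk_iff :
    HasLiftingProperty (initial.to (freeDisk A α n)) p ↔
      Function.Surjective ((p.app α).f n) := by
  constructor
  · intro _ y
    have sq : CommSq (initial.to F) (initial.to (freeDisk A α n)) p (freeDiskDesc y) :=
      ⟨initial.hom_ext _ _⟩
    refine ⟨(sq.lift.app α).f n (freeDiskGen A α n), ?_⟩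
    rw [← comp_app_f_apply, sq.fac_right, freeDiskDesc_gen]
  · refine fun hp => ⟨fun {f g} _ => ⟨?_⟩⟩
    obtain ⟨x, hx⟩ := hp ((g.app α).f n (freeDiskGen A α n))
    exact ⟨
      { l := freeDiskDesc x
        fac_left := initial.hom_ext _ _
        fac_right := by
          ext
          rw [comp_app_f_apply, freeDiskDesc_gen, hx] }⟩

lemma exists_lift_of_hasLiftingProperty_sphereInclusion
    [HasLiftingProperty (sphereInclusion A α n) p] (x : (F.obj α).X (n + 1)) (y : (G.obj α).X n)
    (hx : (F.obj α).d (n + 1) (n + 1 + 1) x = 0)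
    (hy : (G.obj α).d n (n + 1) y = (p.app α).f (n + 1) x) :
    ∃ z, (F.obj α).d n (n + 1) z = x ∧ (p.app α).f n z = y := by
  have sq : CommSq (sphereDesc x hx) (sphereInclusion A α n) p (freeDiskDesc y) := ⟨by
    ext
    rw [comp_app_f_apply, sphereDesc_gen, sphereInclusion_comp_gen, freeDiskDesc_gen, hy]⟩
  refine ⟨(sq.lift.app α).f n (freeDiskGen A α n), ?_, ?_⟩
  · rw [← sphereInclusion_comp_gen, sq.fac_left, sphereDesc_gen]
  · rw [← comp_app_f_apply, sq.fac_right, freeDiskDesc_gen]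

lemma hasLiftingProperty_sphereInclusion_iff :
    HasLiftingProperty (sphereInclusion A α n) p ↔
      ∀ (x : (F.obj α).X (n + 1)) (y : (G.obj α).X n),
        (F.obj α).d (n + 1) (n + 1 + 1) x = 0 →
        (G.obj α).d n (n + 1) y = (p.app α).f (n + 1) x →
        ∃ z, (F.obj α).d n (n + 1) z = x ∧ (p.app α).f n z = y := by
  refine ⟨fun _ => exists_lift_of_hasLiftingProperty_sphereInclusion,
    fun hp => ⟨fun {f g} sq => ⟨?_⟩⟩⟩
  obtain ⟨z, hz₁, hz₂⟩ := hp ((f.app α).f (n + 1) (sphereGen A α (n + 1)))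
    ((g.app α).f n (freeDiskGen A α n))
    (by rw [DGMod.d_f_apply, d_sphereGen, map_zero])
    (by rw [← comp_app_f_apply, sq.w, sphereInclusion_comp_gen])
  exact ⟨
    { l := freeDiskDesc z
      fac_left := by
        ext
        rw [sphereInclusion_comp_gen, freeDiskDesc_gen, hz₁]
      fac_right := by
        ext
        rw [comp_app_f_apply, freeDiskDesc_gen, hz₂] }⟩

variable (A)

/-- The generating cofibrations. -/
def genCof : MorphismProperty (DiagMod A) :=
  .ofHoms (fun i : N × ℤ => sphereInclusion A i.1 i.2)

/-- The generating trivial cofibrations. -/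
def genTrivCof : MorphismProperty (DiagMod A) :=
  .ofHoms (fun i : N × ℤ => initial.to (freeDisk A i.1 i.2))

variable {A}

lemma rlp_ofHoms_iff {ι C : Type*} [Category* C] {X Y : ι → C} (f : ∀ i, X i ⟶ Y i)
    {Z W : C} (p : Z ⟶ W) :
    (MorphismProperty.ofHoms f).rlp p ↔ ∀ i, HasLiftingProperty (f i) p :=
  ⟨fun h i => h _ (.mk i), fun h _ _ _ ⟨i⟩ => h i⟩

lemma genTrivCof_rlp : (genTrivCof A).rlp = fib A := by
  ext F G p
  rw [genTrivCof, rlp_ofHoms_iff, Prod.forall]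
  exact forall₂_congr fun _ _ => hasLiftingProperty_initial_to_freeDisk_iff

lemma genCof_rlp : (genCof A).rlp = fib A ⊓ weq A := by
  ext F G p
  rw [genCof, rlp_ofHoms_iff, Prod.forall]
  calc (∀ α n, HasLiftingProperty (sphereInclusion A α n) p)
      ↔ ∀ α, DGMod.fib _ (p.app α) ∧ QuasiIso (p.app α) := forall_congr' fun α => by
        rw [DGMod.fib_and_quasiIso_iff]
        exact forall_congr' fun _ => hasLiftingProperty_sphereInclusion_iff
    _ ↔ (fib A ⊓ weq A) p := forall_and

end Lifting

section SmallObject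

attribute [local instance] Cardinal.fact_isRegular_aleph0 Cardinal.orderBotAleph0OrdToType

variable {N : Type u} [SmallCategory N] (A : N ⥤ CommRingCat.{u}) (α : N) (n : ℤ)

instance : IsFinitelyPresentable.{u} (freeDisk A α n) :=
  isFinitelyPresentable_iff_preservesFilteredColimits.mpr
    ⟨fun _ _ _ => preservesColimitsOfShape_of_natIso (elements A α n).coreprW.symm⟩

instance : IsFinitelyPresentable.{u} (sphere A α n) := by
  let D := parallelPair
    (freeDiskDesc (((freeDisk A α n).obj α).d n (n + 1) (freeDiskGen A α n)))
    (freeDiskDesc (0 : ((freeDisk A α n).obj α).X (n + 1)))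
  have (k : WalkingParallelPair) : IsFinitelyPresentable.{u} (D.obj k) := by
    cases k <;> dsimp only [D, parallelPair_obj_zero, parallelPair_obj_one] <;> infer_instance
  exact isCardinalPresentable_of_isColimit _ (colimit.isColimit D) Cardinal.aleph0.{u}
    (hasCardinalLT_aleph0_iff _ |>.mpr inferInstance)

instance {C : Type*} [Category.{u} C] [HasInitial C] : IsFinitelyPresentable.{u} (⊥_ C) := by
  have (k : Discrete PEmpty.{1}) : IsFinitelyPresentable.{u} ((Functor.empty.{0} C).obj k) :=
    k.as.elim
  exact isCardinalPresentable_of_isColimit _ (colimit.isColimit (Functor.empty.{0} C))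
    Cardinal.aleph0.{u} (hasCardinalLT_aleph0_iff _ |>.mpr inferInstance)

lemma hasSmallObjectArgument_ofHoms {C : Type*} [Category.{u} C] [HasColimitsOfSize.{u, u} C]
    {ι : Type u} {X Y : ι → C} (f : ∀ i, X i ⟶ Y i) [∀ i, IsFinitelyPresentable.{u} (X i)] :
    (MorphismProperty.ofHoms f).HasSmallObjectArgument.{u} := by
  have : (MorphismProperty.ofHoms f).IsCardinalForSmallObjectArgument Cardinal.aleph0.{u} :=
    { isSmall := MorphismProperty.isSmall_ofHoms _
      preservesColimit := by
        rintro _ _ _ _ _ ⟨i⟩ f hf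
        infer_instance }
  exact ⟨.aleph0, inferInstance, inferInstance, inferInstance⟩

instance : (genCof A).HasSmallObjectArgument.{u} := hasSmallObjectArgument_ofHoms _

instance : (genTrivCof A).HasSmallObjectArgument.{u} := hasSmallObjectArgument_ofHoms _

end SmallObject

end DiagMod

/-! ### Latching modules -/

namespace DiagMod

section Latching

variable {N : Type u} [PartialOrder N] {A : N ⥤ CommRingCat.{u}} {α : N}

/-- The semilinear maps `F_γ → L_α F` for `γ < α`. -/
def latchingι (F : DiagMod A) {γ : N} (h : γ < α) (n : ℤ) :
    (F.obj γ).X n →ₛₗ[(A.map (homOfLE h.le)).hom] (F.latching α).X n :=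
  ((colimit.ι (F.latchingDiagram α) ⟨γ, h⟩).f n).hom.comp (DGMod.unit _ (F.obj γ) n)

lemma latchingι_apply (F : DiagMod A) {γ : N} (h : γ < α) (n : ℤ) (x : (F.obj γ).X n) :
    F.latchingι h n x =
      (colimit.ι (F.latchingDiagram α) ⟨γ, h⟩).f n (DGMod.unit _ (F.obj γ) n x) := rfl

lemma latching_hom_ext {F : DiagMod A} {M : DGMod (A.obj α)} {a b : F.latching α ⟶ M}
    (h : ∀ {γ : N} (h : γ < α) n x, a.f n (F.latchingι h n x) = b.f n (F.latchingι h n x)) :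
    a = b :=
  colimit.hom_ext fun γ => DGMod.extend_hom_ext _ (h γ.2)

lemma d_latchingι (F : DiagMod A) {γ : N} (h : γ < α) (i j : ℤ) (x : (F.obj γ).X i) :
    (F.latching α).d i j (F.latchingι h i x) = F.latchingι h j ((F.obj γ).d i j x) := by
  rw [latchingι_apply, latchingι_apply, ← DGMod.extend_d_unit]
  exact DGMod.d_f_apply (colimit.ι (F.latchingDiagram α) ⟨γ, h⟩) i j _

lemma latchingTransition_unit (F : DiagMod A) {γ δ : N} (h : γ ≤ δ) (h' : δ ≤ α) (n : ℤ)
    (x : (F.obj γ).X n) :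
    (F.latchingTransition h h').f n (DGMod.unit _ (F.obj γ) n x) =
      DGMod.unit _ (F.obj δ) n (F.res (homOfLE h) n x) := by
  rw [latchingTransition, HomologicalComplex.comp_f, ModuleCat.comp_apply,
    DGMod.extendComp_unit, DGMod.extend_map_unit, res_apply]

lemma latchingι_res (F : DiagMod A) {γ δ : N} (h : γ ≤ δ) (h' : δ < α) (n : ℤ)
    (x : (F.obj γ).X n) :
    F.latchingι h' n (F.res (homOfLE h) n x) = F.latchingι (h.trans_lt h') n x := by
  have w := colimit.w (F.latchingDiagram α)
    (homOfLE h : (⟨γ, h.trans_lt h'⟩ : {γ : N // γ < α}) ⟶ ⟨δ, h'⟩)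
  rw [latchingι_apply, ← latchingTransition_unit F h h'.le]
  exact congr(($w).f n (DGMod.unit _ (F.obj γ) n x))

section Desc

variable {F : DiagMod A} {M : DGMod (A.obj α)}
  (v : ∀ {γ : N} (h : γ < α) (n : ℤ), (F.obj γ).X n →ₛₗ[(A.map (homOfLE h.le)).hom] M.X n)
  (hd : ∀ {γ : N} (h : γ < α) (n : ℤ) x,
    M.d n (n + 1) (v h n x) = v h (n + 1) ((F.obj γ).d n (n + 1) x))
  (hv : ∀ {γ δ : N} (h : γ ≤ δ) (h' : δ < α) n x,
    v h' n (F.res (homOfLE h) n x) = v (h.trans_lt h') n x)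

/-- The cocone on the latching diagram given by compatible semilinear maps `F_γ → M`. -/
def latchingCocone : Cocone (F.latchingDiagram α) where
  pt := M
  ι :=
    { app := fun γ => DGMod.extendDesc _ (v γ.2) (hd γ.2)
      naturality := fun γ δ s => by
        refine Eq.trans (DGMod.extend_hom_ext _ fun n x => ?_) (Category.comp_id _).symm
        calc (DGMod.extendDesc _ (v δ.2) (hd δ.2)).f n
              ((F.latchingTransition (leOfHom s) δ.2.le).f n (DGMod.unit _ (F.obj γ) n x))
            = v δ.2 n (F.res (homOfLE (leOfHom s)) n x) := by
              rw [latchingTransition_unit, DGMod.extendDesc_unit]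
          _ = v γ.2 n x := hv _ _ _ _
          _ = (DGMod.extendDesc _ (v γ.2) (hd γ.2)).f n (DGMod.unit _ (F.obj γ) n x) :=
              (DGMod.extendDesc_unit _ _ _ n x).symm }

/-- The morphism `L_α F ⟶ M` given by compatible semilinear maps `F_γ → M`. -/
def latchingDesc : F.latching α ⟶ M :=
  colimit.desc (F.latchingDiagram α) (latchingCocone v hd hv)

lemma latchingDesc_latchingι {γ : N} (h : γ < α) (n : ℤ) (x : (F.obj γ).X n) :
    (latchingDesc v hd hv).f n (F.latchingι h n x) = v h n x :=
  congr(($(colimit.ι_desc (latchingCocone v hd hv) ⟨γ, h⟩)).f n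
    (DGMod.unit _ (F.obj γ) n x)).trans (DGMod.extendDesc_unit _ (v h) (hd h) n x)

end Desc

lemma latchingMap_latchingι (F : DiagMod A) {γ : N} (h : γ < α) (n : ℤ) (x : (F.obj γ).X n) :
    (F.latchingMap α).f n (F.latchingι h n x) = F.res (homOfLE h.le) n x := by
  have w : colimit.ι (F.latchingDiagram α) ⟨γ, h⟩ ≫ F.latchingMap α = F.map (homOfLE h.le) :=
    colimit.ι_desc _ _
  exact congr(($w).f n (DGMod.unit _ (F.obj γ) n x))

lemma mapLatching_latchingι {F G : DiagMod A} (φ : F ⟶ G) {γ : N} (h : γ < α) (n : ℤ)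
    (x : (F.obj γ).X n) :
    (mapLatching φ α).f n (F.latchingι h n x) = G.latchingι h n ((φ.app γ).f n x) := by
  have w : colimit.ι (F.latchingDiagram α) ⟨γ, h⟩ ≫ mapLatching φ α =
      (DGMod.extend (A.map (homOfLE h.le))).map (φ.app γ) ≫
        colimit.ι (G.latchingDiagram α) ⟨γ, h⟩ := ι_colimMap _ _
  rw [latchingι_apply, latchingι_apply, ← DGMod.extend_map_unit]
  exact congr(($w).f n (DGMod.unit _ (F.obj γ) n x))

lemma mapLatching_comp {F G H : DiagMod A} (φ : F ⟶ G) (ψ : G ⟶ H) :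
    mapLatching (φ ≫ ψ) α = mapLatching φ α ≫ mapLatching ψ α :=
  latching_hom_ext fun h n x => by
    rw [HomologicalComplex.comp_f, ModuleCat.comp_apply, mapLatching_latchingι,
      mapLatching_latchingι, mapLatching_latchingι, comp_app_f_apply]

lemma inl_relLatchingMap {F G : DiagMod A} (φ : F ⟶ G) :
    pushout.inl (mapLatching φ α) (F.latchingMap α) ≫ relLatchingMap φ α = G.latchingMap α :=
  pushout.inl_desc _ _ _

lemma inr_relLatchingMap {F G : DiagMod A} (φ : F ⟶ G) :
    pushout.inr (mapLatching φ α) (F.latchingMap α) ≫ relLatchingMap φ α = φ.app α :=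
  pushout.inr_desc _ _ _

end Latching

end DiagMod

lemma exists_family_of_wellFoundedLT {N : Type*} [LT N] [WellFoundedLT N] {T : N → Type*}
    [∀ α, Nonempty (T α)] (P : ∀ α, (∀ γ < α, T γ) → T α → Prop)
    (step : ∀ (α : N) (t : ∀ γ, T γ), (∀ γ < α, P γ (fun δ _ => t δ) (t γ)) →
      ∃ x, P α (fun γ _ => t γ) x) :
    ∃ t : ∀ α, T α, ∀ α, P α (fun γ _ => t γ) (t α) := by
  let t : ∀ α, T α := wellFounded_lt.fix fun α t => Classical.epsilon (P α t)
  have ht (α : N) : t α = Classical.epsilon (P α fun γ _ => t γ) := wellFounded_lt.fix_eq _ α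
  refine ⟨t, fun α => ?_⟩
  induction α using WellFoundedLT.induction with
  | ind α ih =>
    rw [ht α]
    exact Classical.epsilon_spec (step α t ih)

namespace DiagMod

section RelativeLatching

variable {N : Type u} [PartialOrder N] {A : N ⥤ CommRingCat.{u}} {α : N} {F G : DiagMod A}
  {φ : F ⟶ G}

lemma hasLiftingProperty_relLatchingMap_iff {M M' : DGMod (A.obj α)} {p : M ⟶ M'} :
    HasLiftingProperty (relLatchingMap φ α) p ↔
      ∀ (u : G.latching α ⟶ M) (f : F.obj α ⟶ M) (g : G.obj α ⟶ M'),
        mapLatching φ α ≫ u = F.latchingMap α ≫ f → u ≫ p = G.latchingMap α ≫ g →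
        f ≫ p = φ.app α ≫ g →
        ∃ l : G.obj α ⟶ M, G.latchingMap α ≫ l = u ∧ φ.app α ≫ l = f ∧ l ≫ p = g := by
  constructor
  · intro _ u f g huf hu hf
    have sq : CommSq (pushout.desc u f huf) (relLatchingMap φ α) p g := ⟨by
      ext1
      · rw [pushout.inl_desc_assoc, reassoc_of% inl_relLatchingMap, hu]
      · rw [pushout.inr_desc_assoc, reassoc_of% inr_relLatchingMap, hf]⟩
    refine ⟨sq.lift, ?_, ?_, sq.fac_right⟩
    · rw [← inl_relLatchingMap φ, Category.assoc, sq.fac_left, pushout.inl_desc]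
    · rw [← inr_relLatchingMap φ, Category.assoc, sq.fac_left, pushout.inr_desc]
  · refine fun H => ⟨fun {v g} sq => ?_⟩
    obtain ⟨l, hu, hf, hg⟩ := H (pushout.inl _ _ ≫ v) (pushout.inr _ _ ≫ v) g
      (pushout.condition_assoc v) (by rw [Category.assoc, sq.w, reassoc_of% inl_relLatchingMap])
      (by rw [Category.assoc, sq.w, reassoc_of% inr_relLatchingMap])
    exact ⟨⟨
      { l
        fac_left := by
          ext1
          · rw [reassoc_of% inl_relLatchingMap, hu]
          · rw [reassoc_of% inr_relLatchingMap, hf]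
        fac_right := hg }⟩⟩

variable {X Y : DiagMod A} {f : F ⟶ X} {g : G ⟶ Y} {p : X ⟶ Y}

/-- For a commutative square with sides `f`, `φ`, `p`, `g`, the morphism `l` is a lift at `α`
which is compatible with the lifts `t γ` at the indices `γ < α`. -/
structure IsCompatibleLift (f : F ⟶ X) (φ : F ⟶ G) (p : X ⟶ Y) (g : G ⟶ Y) (α : N)
    (t : ∀ γ < α, G.obj γ ⟶ X.obj γ) (l : G.obj α ⟶ X.obj α) : Prop where
  fac_left : φ.app α ≫ l = f.app α
  fac_right : l ≫ p.app α = g.app α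
  res {γ : N} (h : γ < α) (n : ℤ) (x : (G.obj γ).X n) :
    l.f n (G.res (homOfLE h.le) n x) = X.res (homOfLE h.le) n ((t γ h).f n x)

lemma exists_latching_hom (t : ∀ γ, G.obj γ ⟶ X.obj γ)
    (ht : ∀ γ < α, IsCompatibleLift f φ p g γ (fun δ _ => t δ) (t γ)) :
    ∃ u : G.latching α ⟶ X.obj α, ∀ {γ : N} (h : γ < α) n x,
      u.f n (G.latchingι h n x) = X.res (homOfLE h.le) n ((t γ).f n x) := by
  refine ⟨latchingDesc (fun {γ} h n => (X.res (homOfLE h.le) n).comp ((t γ).f n).hom)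
    (fun h n x => ?_) (fun {γ δ} h h' n x => ?_), latchingDesc_latchingι _ _ _⟩
  · exact (d_res X _ _ _ _).trans (congrArg _ (DGMod.d_f_apply _ _ _ _))
  · obtain rfl | hlt := h.eq_or_lt
    · exact congrArg (fun y => X.res _ n ((t γ).f n y)) (res_id G γ n x)
    · exact (congrArg _ ((ht δ h').res hlt n x)).trans (res_comp X _ _ _ _).symm

lemma exists_isCompatibleLift (sq : CommSq f φ p g)
    [HasLiftingProperty (relLatchingMap φ α) (p.app α)] (t : ∀ γ, G.obj γ ⟶ X.obj γ)
    (ht : ∀ γ < α, IsCompatibleLift f φ p g γ (fun δ _ => t δ) (t γ)) :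
    ∃ l, IsCompatibleLift f φ p g α (fun γ _ => t γ) l := by
  obtain ⟨u, hu⟩ := exists_latching_hom t ht
  have left {γ : N} (h : γ < α) n x : (t γ).f n ((φ.app γ).f n x) = (f.app γ).f n x :=
    congr(($((ht γ h).fac_left)).f n x)
  have right {γ : N} (h : γ < α) n x : (p.app γ).f n ((t γ).f n x) = (g.app γ).f n x :=
    congr(($((ht γ h).fac_right)).f n x)
  obtain ⟨l, hlu, hlf, hlg⟩ := hasLiftingProperty_relLatchingMap_iff.mp ‹_› u (f.app α) (g.app α)
    (latching_hom_ext fun h n x => by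
      simp only [HomologicalComplex.comp_f, ModuleCat.comp_apply, mapLatching_latchingι, hu,
        latchingMap_latchingι, app_res, left h])
    (latching_hom_ext fun h n x => by
      simp only [HomologicalComplex.comp_f, ModuleCat.comp_apply, hu, latchingMap_latchingι,
        app_res, right h])
    congr(Hom.app $(sq.w) α)
  refine ⟨l, hlf, hlg, fun h n x => ?_⟩
  rw [← hu, ← hlu, ← latchingMap_latchingι G h, HomologicalComplex.comp_f, ModuleCat.comp_apply]

lemma llp_of_relLatchingMap [WellFoundedLT N] (hφ : ∀ α, DGMod.cof _ (relLatchingMap φ α)) :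
    (fib A ⊓ weq A).llp φ := by
  rintro X Y p ⟨hp, hp'⟩
  refine ⟨fun {f g} sq => ?_⟩
  obtain ⟨t, ht⟩ := exists_family_of_wellFoundedLT (IsCompatibleLift f φ p g) fun α t ht =>
    have := hφ α (p.app α) ⟨hp α, hp' α⟩
    exists_isCompatibleLift sq t ht
  refine ⟨⟨
    { l := homOfRes t fun {γ α} s n x => ?_
      fac_left := hom_ext fun α => (ht α).fac_left
      fac_right := hom_ext fun α => (ht α).fac_right }⟩⟩
  obtain rfl | hlt := (leOfHom s).eq_or_lt
  · obtain rfl : s = 𝟙 _ := Subsingleton.elim _ _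
    rw [res_id, res_id]
  · exact (ht α).res hlt n x

end RelativeLatching

end DiagMod

/-! ### Cofree modules -/

namespace DiagMod

section Cofree

variable {N : Type u} [PartialOrder N] {A : N ⥤ CommRingCat.{u}} {α : N}

instance {γ δ : N} (s : γ ⟶ δ) (h : δ ≤ α) : RingHomCompTriple (A.map s).hom
    (A.map (homOfLE h)).hom (A.map (homOfLE ((leOfHom s).trans h))).hom where
  comp_eq := by
    rw [← CommRingCat.hom_comp, ← A.map_comp]
    rfl

variable {M M' : DGMod (A.obj α)} (p : M ⟶ M')

/-- The families which consist of an element of `M^n` if `γ < α` and of an element of `M'^n` if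
`γ ≤ α`, compatible with `p`. The indices `PLift _` only serve to form products over
propositions. -/
def cofreeSubmodule (γ : N) (n : ℤ) : Submodule (A.obj γ)
    ((∀ h : PLift (γ < α), (ModuleCat.restrictScalars
        (A.map (homOfLE h.down.le)).hom).obj (M.X n)) ×
      (∀ h : PLift (γ ≤ α), (ModuleCat.restrictScalars
        (A.map (homOfLE h.down)).hom).obj (M'.X n))) where
  carrier := {x | ∀ h : γ < α, p.f n (x.1 ⟨h⟩ : M.X n) = (x.2 ⟨h.le⟩ : M'.X n)}
  add_mem' {x y} hx hy h :=
    (map_add (p.f n).hom (x.1 ⟨h⟩ : M.X n) (y.1 ⟨h⟩ : M.X n)).trans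
      (congrArg₂ (fun a b : M'.X n => a + b) (hx h) (hy h))
  zero_mem' _ := map_zero (p.f n).hom
  smul_mem' a x hx h :=
    (map_smul (p.f n).hom (A.map (homOfLE h.le) a) (x.1 ⟨h⟩ : M.X n)).trans
      (congrArg (fun y : M'.X n => A.map (homOfLE h.le) a • y) (hx h))

namespace cofreeSubmodule

variable {p} {γ : N} {n : ℤ}

variable (p n) in
/-- The component in `M`. -/
def fst (h : γ < α) : cofreeSubmodule p γ n →ₛₗ[(A.map (homOfLE h.le)).hom] M.X n where
  toFun x := x.1.1 ⟨h⟩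
  map_add' _ _ := rfl
  map_smul' _ _ := rfl

variable (p n) in
/-- The component in `M'`. -/
def snd (h : γ ≤ α) : cofreeSubmodule p γ n →ₛₗ[(A.map (homOfLE h)).hom] M'.X n where
  toFun x := x.1.2 ⟨h⟩
  map_add' _ _ := rfl
  map_smul' _ _ := rfl

lemma map_fst (h : γ < α) (x : cofreeSubmodule p γ n) :
    p.f n (fst p n h x) = snd p n h.le x := x.2 h

@[ext]
lemma ext {x y : cofreeSubmodule p γ n} (h₁ : ∀ h, fst p n h x = fst p n h y)
    (h₂ : ∀ h, snd p n h x = snd p n h y) : x = y :=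
  Subtype.ext (Prod.ext (funext fun h => h₁ h.down) (funext fun h => h₂ h.down))

/-- The element with given components. -/
def mk (a : γ < α → M.X n) (b : γ ≤ α → M'.X n) (h : ∀ h : γ < α, p.f n (a h) = b h.le) :
    cofreeSubmodule p γ n :=
  ⟨(fun h => a h.down, fun h => b h.down), h⟩

/-- The semilinear map with given components. -/
@[simps]
def lift {R : Type u} [CommRing R] {L : Type u} [AddCommGroup L] [Module R L] {σ : R →+* A.obj γ}
    (τ : γ ≤ α → R →+* A.obj α) [∀ h, RingHomCompTriple σ (A.map (homOfLE h)).hom (τ h)]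
    (a : ∀ h : γ < α, L →ₛₗ[τ h.le] M.X n) (b : ∀ h : γ ≤ α, L →ₛₗ[τ h] M'.X n)
    (hab : ∀ (h : γ < α) x, p.f n (a h x) = b h.le x) : L →ₛₗ[σ] cofreeSubmodule p γ n where
  toFun x := mk (a · x) (b · x) (hab · x)
  map_add' x y := ext (fun h => map_add (a h) x y) (fun h => map_add (b h) x y)
  map_smul' r x := by
    have hτ (h : γ ≤ α) : τ h r = A.map (homOfLE h) (σ r) :=
      (RingHomCompTriple.comp_apply (σ₂₃ := (A.map (homOfLE h)).hom)).symm
    exact ext (fun h => ((a h).map_smulₛₗ r x).trans congr($(hτ h.le) • a h x))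
      (fun h => ((b h).map_smulₛₗ r x).trans congr($(hτ h) • b h x))

end cofreeSubmodule

open cofreeSubmodule

/-- The value at `γ` of the cofree module. -/
def cofreeObj (γ : N) : DGMod (A.obj γ) where
  X n := ModuleCat.of (A.obj γ) (cofreeSubmodule p γ n)
  d i j := ModuleCat.ofHom <| cofreeSubmodule.lift (fun h => (A.map (homOfLE h)).hom)
    (fun h => (M.d i j).hom.comp (fst p i h)) (fun h => (M'.d i j).hom.comp (snd p i h))
    (fun h x => (DGMod.d_f_apply p i j _).symm.trans (congrArg _ (map_fst h x)))
  shape i j hij := by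
    ext x : 2
    exact cofreeSubmodule.ext (fun h => congr($(M.shape i j hij) (fst p i h x)))
      (fun h => congr($(M'.shape i j hij) (snd p i h x)))
  d_comp_d' i j k _ _ := by
    ext x : 2
    exact cofreeSubmodule.ext (fun h => DGMod.d_d_apply M i j k (fst p i h x))
      (fun h => DGMod.d_d_apply M' i j k (snd p i h x))

/-- The module over a diagram of rings cofreely generated by `p`: morphisms `F ⟶ cofree p`
correspond to commutative squares from `L_α F ⟶ F_α` to `p`. -/
def cofree : DiagMod A :=
  ofRes (cofreeObj p)
    (fun {_ _} s n => cofreeSubmodule.lift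
      (fun h => (A.map (homOfLE ((leOfHom s).trans h))).hom)
      (fun h => fst p n ((leOfHom s).trans_lt h)) (fun h => snd p n ((leOfHom s).trans h))
      (fun h => map_fst ((leOfHom s).trans_lt h)))
    (fun _ _ _ => rfl) (fun _ _ _ => rfl) (fun _ _ _ _ => rfl)

/-- The components in `M` of the elements of a cofree module. -/
def cofreeFst {γ : N} (h : γ < α) (n : ℤ) :
    ((cofree p).obj γ).X n →ₛₗ[(A.map (homOfLE h.le)).hom] M.X n := fst p n h

/-- The components in `M'` of the elements of a cofree module. -/
def cofreeSnd {γ : N} (h : γ ≤ α) (n : ℤ) :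
    ((cofree p).obj γ).X n →ₛₗ[(A.map (homOfLE h)).hom] M'.X n := snd p n h

variable {p}

lemma map_cofreeFst {γ : N} (h : γ < α) {n : ℤ} (x : ((cofree p).obj γ).X n) :
    p.f n (cofreeFst p h n x) = cofreeSnd p h.le n x := map_fst h x

lemma cofree_ext {γ : N} {n : ℤ} {x y : ((cofree p).obj γ).X n}
    (h₁ : ∀ h, cofreeFst p h n x = cofreeFst p h n y)
    (h₂ : ∀ h, cofreeSnd p h n x = cofreeSnd p h n y) : x = y :=
  cofreeSubmodule.ext h₁ h₂

lemma exists_cofree {γ : N} {n : ℤ} (a : γ < α → M.X n) (b : γ ≤ α → M'.X n)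
    (hab : ∀ h : γ < α, p.f n (a h) = b h.le) :
    ∃ x : ((cofree p).obj γ).X n, (∀ h, cofreeFst p h n x = a h) ∧ ∀ h, cofreeSnd p h n x = b h :=
  ⟨cofreeSubmodule.mk a b hab, fun _ => rfl, fun _ => rfl⟩

lemma d_cofreeFst {γ : N} (h : γ < α) (i j : ℤ) (x : ((cofree p).obj γ).X i) :
    M.d i j (cofreeFst p h i x) = cofreeFst p h j (((cofree p).obj γ).d i j x) := rfl

lemma d_cofreeSnd {γ : N} (h : γ ≤ α) (i j : ℤ) (x : ((cofree p).obj γ).X i) :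
    M'.d i j (cofreeSnd p h i x) = cofreeSnd p h j (((cofree p).obj γ).d i j x) := rfl

lemma cofreeFst_res {γ δ : N} (h : γ ≤ δ) (h' : δ < α) (n : ℤ) (x : ((cofree p).obj γ).X n) :
    cofreeFst p h' n ((cofree p).res (homOfLE h) n x) = cofreeFst p (h.trans_lt h') n x :=
  congrArg (fst p n h') (ofRes_res (cofreeObj p) _ _ _ _ (homOfLE h) n x)

lemma cofreeSnd_res {γ δ : N} (h : γ ≤ δ) (h' : δ ≤ α) (n : ℤ) (x : ((cofree p).obj γ).X n) :
    cofreeSnd p h' n ((cofree p).res (homOfLE h) n x) = cofreeSnd p (h.trans h') n x :=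
  congrArg (snd p n h') (ofRes_res (cofreeObj p) _ _ _ _ (homOfLE h) n x)

variable (p) in
/-- The universal map from the latching module of a cofree module. -/
def latchingCofree : (cofree p).latching α ⟶ M :=
  latchingDesc (cofreeFst p) (fun h _ => d_cofreeFst h _ _) cofreeFst_res

variable (p) in
/-- The universal map from the value at `α` of a cofree module. -/
def evalCofree : (cofree p).obj α ⟶ M' where
  f n := ModuleCat.ofHom
    { toFun := cofreeSnd p le_rfl n
      map_add' := map_add _
      map_smul' := fun c x => by
        have map_refl : A.map (homOfLE (le_refl α)) c = c := congr($(A.map_id α) c)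
        exact ((cofreeSnd p le_rfl n).map_smulₛₗ c x).trans
          congr($map_refl • cofreeSnd p le_rfl n x) }
  comm' i j _ := by
    ext x
    exact d_cofreeSnd le_rfl i j x

lemma evalCofree_apply {n : ℤ} (x : ((cofree p).obj α).X n) :
    (evalCofree p).f n x = cofreeSnd p le_rfl n x := rfl

lemma latchingCofree_latchingι {γ : N} (h : γ < α) {n : ℤ} (x : ((cofree p).obj γ).X n) :
    (latchingCofree p).f n ((cofree p).latchingι h n x) = cofreeFst p h n x :=
  latchingDesc_latchingι (cofreeFst p) (fun h _ => d_cofreeFst h _ _) cofreeFst_res h n x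

lemma latchingCofree_comp : latchingCofree p ≫ p = (cofree p).latchingMap α ≫ evalCofree p :=
  latching_hom_ext fun h n x => by
    simp only [HomologicalComplex.comp_f, ModuleCat.comp_apply, latchingCofree_latchingι,
      latchingMap_latchingι, evalCofree_apply, cofreeSnd_res, map_cofreeFst]

section Lift

variable {F : DiagMod A}

lemma cofree_hom_ext {a b : F ⟶ cofree p}
    (h₁ : mapLatching a α ≫ latchingCofree p = mapLatching b α ≫ latchingCofree p)
    (h₂ : a.app α ≫ evalCofree p = b.app α ≫ evalCofree p) : a = b := by
  ext γ n x
  refine cofree_ext (fun h => ?_) (fun h => ?_)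
  · have := congr(($h₁).f n (F.latchingι h n x))
    simpa only [HomologicalComplex.comp_f, ModuleCat.comp_apply, mapLatching_latchingι,
      latchingCofree_latchingι] using this
  · have := congr(($h₂).f n (F.res (homOfLE h) n x))
    simpa only [HomologicalComplex.comp_f, ModuleCat.comp_apply, app_res, evalCofree_apply,
      cofreeSnd_res] using this

variable (v : F.latching α ⟶ M) (w : F.obj α ⟶ M') (hvw : v ≫ p = F.latchingMap α ≫ w)

/-- The component at `γ` of the morphism to a cofree module given by a commutative square. -/
def cofreeLiftApp (γ : N) : F.obj γ ⟶ (cofree p).obj γ where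
  f n := ModuleCat.ofHom (Y := ((cofree p).obj γ).X n) <| cofreeSubmodule.lift
    (fun h => (A.map (homOfLE h)).hom)
    (fun h => (v.f n).hom.comp (F.latchingι h n))
    (fun h => (w.f n).hom.comp (F.res (homOfLE h) n))
    (fun h x => congr(($hvw).f n (F.latchingι h n x)).trans
      (congrArg (w.f n) (latchingMap_latchingι F h n x)))
  comm' i j _ := by
    ext x
    refine cofree_ext (fun h => ?_) (fun h => ?_)
    · exact (DGMod.d_f_apply v i j _).trans (congrArg (v.f j) (d_latchingι F h i j x))
    · exact (DGMod.d_f_apply w i j _).trans (congrArg (w.f j) (d_res F (homOfLE h) i j x))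

/-- The morphism to a cofree module given by a commutative square. -/
def cofreeLift : F ⟶ cofree p :=
  homOfRes (cofreeLiftApp v w hvw) fun {γ _} s n x => cofree_ext
    (fun h => (congrArg (v.f n) (latchingι_res F (leOfHom s) h n x)).trans
      (cofreeFst_res (leOfHom s) h n ((cofreeLiftApp v w hvw γ).f n x)).symm)
    (fun h => (congrArg (w.f n) (res_comp F s (homOfLE h) n x).symm).trans
      (cofreeSnd_res (leOfHom s) h n ((cofreeLiftApp v w hvw γ).f n x)).symm)

lemma cofreeFst_cofreeLift {γ : N} (h : γ < α) {n : ℤ} (x : (F.obj γ).X n) :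
    cofreeFst p h n (((cofreeLift v w hvw).app γ).f n x) = v.f n (F.latchingι h n x) := rfl

lemma cofreeSnd_cofreeLift {γ : N} (h : γ ≤ α) {n : ℤ} (x : (F.obj γ).X n) :
    cofreeSnd p h n (((cofreeLift v w hvw).app γ).f n x) = w.f n (F.res (homOfLE h) n x) := rfl

@[simp]
lemma mapLatching_cofreeLift : mapLatching (cofreeLift v w hvw) α ≫ latchingCofree p = v :=
  latching_hom_ext fun h n x => by
    rw [HomologicalComplex.comp_f, ModuleCat.comp_apply, mapLatching_latchingι,
      latchingCofree_latchingι, cofreeFst_cofreeLift]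

@[simp]
lemma cofreeLift_app : (cofreeLift v w hvw).app α ≫ evalCofree p = w := by
  ext n x
  rw [HomologicalComplex.comp_f, ModuleCat.comp_apply, evalCofree_apply, cofreeSnd_cofreeLift]
  exact congrArg (w.f n) (res_id F α n x)

end Lift

end Cofree

section CofreeMap

variable {N : Type u} [PartialOrder N] {A : N ⥤ CommRingCat.{u}} {α : N}
  {M M' : DGMod (A.obj α)} (p : M ⟶ M')

/-- The morphism of cofree modules given by the square with sides `𝟙 M`, `𝟙 M`, `p`, `p`. -/
def cofreeMap : cofree (𝟙 M) ⟶ cofree p :=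
  cofreeLift (latchingCofree (𝟙 M)) (evalCofree (𝟙 M) ≫ p)
    (by rw [← Category.assoc, ← latchingCofree_comp, Category.comp_id])

variable {p}

lemma cofreeFst_cofreeMap {γ : N} (h : γ < α) {n : ℤ} (x : ((cofree (𝟙 M)).obj γ).X n) :
    cofreeFst p h n (((cofreeMap p).app γ).f n x) = cofreeFst (𝟙 M) h n x := by
  rw [cofreeMap, cofreeFst_cofreeLift, latchingCofree_latchingι]

lemma cofreeSnd_cofreeMap {γ : N} (h : γ ≤ α) {n : ℤ} (x : ((cofree (𝟙 M)).obj γ).X n) :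
    cofreeSnd p h n (((cofreeMap p).app γ).f n x) = p.f n (cofreeSnd (𝟙 M) h n x) := by
  rw [cofreeMap, cofreeSnd_cofreeLift, HomologicalComplex.comp_f, ModuleCat.comp_apply,
    evalCofree_apply, cofreeSnd_res]

lemma cofreeMap_trivialFibration (hp : DGMod.fib _ p) (hp' : QuasiIso p) :
    (fib A ⊓ weq A) (cofreeMap p) := by
  suffices H : ∀ γ, DGMod.fib _ ((cofreeMap p).app γ) ∧ QuasiIso ((cofreeMap p).app γ) from
    ⟨fun γ => (H γ).1, fun γ => (H γ).2⟩
  refine fun γ => (DGMod.fib_and_quasiIso_iff _).2 fun n x y hx hy => ?_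
  have d_fst (h : γ < α) : M.d n (n + 1) (cofreeFst p h n y) = cofreeFst (𝟙 M) h (n + 1) x := by
    rw [d_cofreeFst, hy, cofreeFst_cofreeMap]
  have d_snd (h : γ ≤ α) : M'.d n (n + 1) (cofreeSnd p h n y) =
      p.f (n + 1) (cofreeSnd (𝟙 M) h (n + 1) x) := by
    rw [d_cofreeSnd, hy, cofreeSnd_cofreeMap]
  have exists_snd (h : γ ≤ α) : ∃ z : M.X n, M.d n (n + 1) z = cofreeSnd (𝟙 M) h (n + 1) x ∧
      p.f n z = cofreeSnd p h n y ∧ ∀ h' : γ < α, z = cofreeFst p h' n y := by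
    by_cases h' : γ < α
    · exact ⟨cofreeFst p h' n y, (d_fst h').trans (map_cofreeFst h' x), map_cofreeFst h' y,
        fun _ => rfl⟩
    · obtain ⟨z, hz, hz'⟩ := (DGMod.fib_and_quasiIso_iff p).1 ⟨hp, hp'⟩ n _ _
        (by rw [d_cofreeSnd, hx, map_zero]) (d_snd h)
      exact ⟨z, hz, hz', fun h'' => absurd h'' h'⟩
  choose z hz hpz hz_fst using exists_snd
  obtain ⟨w, hw_fst, hw_snd⟩ := exists_cofree (p := 𝟙 M) (fun h => z h.le) z fun _ => rfl
  refine ⟨w, cofree_ext (fun h => ?_) (fun h => ?_), cofree_ext (fun h => ?_) (fun h => ?_)⟩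
  · rw [← d_cofreeFst, hw_fst, hz]
    exact (map_cofreeFst h x).symm
  · rw [← d_cofreeSnd, hw_snd, hz]
  · rw [cofreeFst_cofreeMap, hw_fst, hz_fst h.le h]
  · rw [cofreeSnd_cofreeMap, hw_snd, hpz]

@[simp]
lemma mapLatching_cofreeMap :
    mapLatching (cofreeMap p) α ≫ latchingCofree p = latchingCofree (𝟙 M) :=
  mapLatching_cofreeLift _ _ _

@[simp]
lemma cofreeMap_app : (cofreeMap p).app α ≫ evalCofree p = evalCofree (𝟙 M) ≫ p :=
  cofreeLift_app _ _ _

lemma relLatchingMap_of_llp {F G : DiagMod A} {φ : F ⟶ G} (hφ : (fib A ⊓ weq A).llp φ) (α : N) :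
    DGMod.cof _ (relLatchingMap φ α) := by
  rintro M M' p ⟨hp, hp'⟩
  rw [hasLiftingProperty_relLatchingMap_iff]
  intro u f g huf hu hf
  have := hφ _ (cofreeMap_trivialFibration hp hp')
  have sq : CommSq (cofreeLift (F.latchingMap α ≫ f) f (Category.comp_id _)) φ (cofreeMap p)
      (cofreeLift u g hu) := ⟨cofree_hom_ext
    (by simp [mapLatching_comp, huf])
    (by rw [comp_app, comp_app, Category.assoc, Category.assoc, cofreeMap_app, cofreeLift_app,
      reassoc_of% cofreeLift_app, hf])⟩
  have left : φ.app α ≫ sq.lift.app α = _ := congr(Hom.app $(sq.fac_left) α)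
  have right : sq.lift.app α ≫ (cofreeMap p).app α = _ := congr(Hom.app $(sq.fac_right) α)
  refine ⟨sq.lift.app α ≫ evalCofree (𝟙 M), ?_, ?_, ?_⟩
  · calc G.latchingMap α ≫ sq.lift.app α ≫ evalCofree (𝟙 M)
        = mapLatching sq.lift α ≫ latchingCofree (𝟙 M) := by
          rw [← reassoc_of% latchingMap_naturality, ← latchingCofree_comp, Category.comp_id]
      _ = mapLatching (sq.lift ≫ cofreeMap p) α ≫ latchingCofree p := by
          rw [mapLatching_comp, Category.assoc, mapLatching_cofreeMap]
      _ = u := by rw [sq.fac_right, mapLatching_cofreeLift]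
  · rw [reassoc_of% left, cofreeLift_app]
  · rw [Category.assoc, ← cofreeMap_app, reassoc_of% right, cofreeLift_app]

end CofreeMap

end DiagMod

/-! ### The model structure -/

namespace DiagMod

section ModelStructure

variable {N : Type u} [SmallCategory N] {A : N ⥤ CommRingCat.{u}}

instance : (weq A).HasTwoOutOfThreeProperty where
  comp_mem f g hf hg α := by
    have := hf α
    have := hg α
    exact quasiIso_comp (f.app α) (g.app α)
  of_postcomp f g hg hfg α := by
    have := hg α
    have : QuasiIso (f.app α ≫ g.app α) := hfg α
    exact quasiIso_of_comp_right (f.app α) (g.app α)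
  of_precomp f g hf hfg α := by
    have := hf α
    have : QuasiIso (f.app α ≫ g.app α) := hfg α
    exact quasiIso_of_comp_left (f.app α) (g.app α)

instance : (fib A).llp.HasFunctorialFactorization (fib A) := by
  rw [← genTrivCof_rlp]
  infer_instance

instance : (fib A ⊓ weq A).llp.HasFunctorialFactorization (fib A ⊓ weq A) := by
  rw [← genCof_rlp]
  infer_instance

instance : (fib A).llp.IsWeakFactorizationSystem (fib A) where
  llp := rfl
  rlp := by rw [← genTrivCof_rlp, MorphismProperty.rlp_llp_rlp]

instance : (fib A ⊓ weq A).llp.IsWeakFactorizationSystem (fib A ⊓ weq A) where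
  llp := rfl
  rlp := by rw [← genCof_rlp, MorphismProperty.rlp_llp_rlp]

lemma llp_inf_weq : (fib A ⊓ weq A).llp ⊓ weq A = (fib A).llp := by
  apply le_antisymm
  · rintro F G φ ⟨hφ, hφ'⟩
    have h := MorphismProperty.factorizationData (fib A).llp (fib A) φ
    have hp : (fib A ⊓ weq A) h.p := ⟨h.hp, (weq A).of_precomp h.i h.p
      (llp_fib_le_weq _ h.hi) (by rwa [h.fac])⟩
    have := hφ _ hp
    exact MorphismProperty.of_retract (RetractArrow.ofLeftLiftingProperty h.fac) h.hi
  · exact le_inf (MorphismProperty.antitone_llp inf_le_left) llp_fib_le_weq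

variable (A)

/-- The fibrations of the model structure. -/
abbrev categoryWithFibrations : CategoryWithFibrations (DiagMod A) := ⟨fib A⟩

/-- The weak equivalences of the model structure. -/
abbrev categoryWithWeakEquivalences : CategoryWithWeakEquivalences (DiagMod A) := ⟨weq A⟩

/-- The cofibrations of the model structure. -/
abbrev categoryWithCofibrations : CategoryWithCofibrations (DiagMod A) := ⟨(fib A ⊓ weq A).llp⟩

attribute [local instance] categoryWithFibrations categoryWithWeakEquivalences
  categoryWithCofibrations

lemma trivialCofibrations_eq : trivialCofibrations (DiagMod A) = (fib A).llp := llp_inf_weq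

/-- The model structure in which weak equivalences and fibrations are defined indexwise. -/
abbrev modelCategory : ModelCategory (DiagMod A) :=
  have : (weakEquivalences (DiagMod A)).HasTwoOutOfThreeProperty :=
    inferInstanceAs (weq A).HasTwoOutOfThreeProperty
  have : (cofibrations (DiagMod A)).IsWeakFactorizationSystem (trivialFibrations (DiagMod A)) :=
    inferInstanceAs ((fib A ⊓ weq A).llp.IsWeakFactorizationSystem (fib A ⊓ weq A))
  have : (trivialCofibrations (DiagMod A)).IsWeakFactorizationSystem (fibrations (DiagMod A)) := by
    rw [trivialCofibrations_eq]
    exact inferInstanceAs ((fib A).llp.IsWeakFactorizationSystem (fib A))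
  ModelCategory.mk' _

end ModelStructure

end DiagMod

end

theorem theorem3p9_general {N : Type u} [PartialOrder N] [WellFoundedLT N]
    (A : N ⥤ CommRingCat.{u}) :
    HasLimits (DiagMod A) ∧ HasColimits (DiagMod A) ∧
    ∃ _ : ModelCategory (DiagMod A),
      (∀ {F G : DiagMod A} (φ : F ⟶ G), WeakEquivalence φ ↔ ∀ α, QuasiIso (φ.app α)) ∧
      (∀ {F G : DiagMod A} (φ : F ⟶ G),
        Fibration φ ↔ ∀ (α : N) (n : ℤ), Function.Surjective ((φ.app α).f n)) ∧
      (∀ {F G : DiagMod A} (φ : F ⟶ G),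
        Cofibration φ ↔ ∀ α, DGMod.cof (A.obj α) (DiagMod.relLatchingMap φ α)) ∧
      (trivialCofibrations (DiagMod A)).HasFunctorialFactorization (fibrations (DiagMod A)) ∧
      (cofibrations (DiagMod A)).HasFunctorialFactorization (trivialFibrations (DiagMod A)) := by
  let _ := DiagMod.modelCategory A
  refine ⟨inferInstance, inferInstance, inferInstance, fun φ => weakEquivalence_iff φ,
    fun φ => fibration_iff φ, fun φ => (cofibration_iff φ).trans
      ⟨DiagMod.relLatchingMap_of_llp, DiagMod.llp_of_relLatchingMap⟩, ?_, ?_⟩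
  · rw [DiagMod.trivialCofibrations_eq]
    exact inferInstanceAs ((DiagMod.fib A).llp.HasFunctorialFactorization (DiagMod.fib A))
  · exact inferInstanceAs ((DiagMod.fib A ⊓ DiagMod.weq A).llp.HasFunctorialFactorization
      (DiagMod.fib A ⊓ DiagMod.weq A))

theorem theorem3p9 {X : Scheme.{u}} [IsNoetherian X] [X.IsSeparated]
    (hdim : topologicalKrullDim X < ⊤) {H : Type u} (U : H → X.Opens)
    (hU : ∀ h, IsAffineOpen (U h)) (hcover : ⨆ h, U h = ⊤) :
    HasLimits (DiagMod (coverDiagram U)) ∧ HasColimits (DiagMod (coverDiagram U)) ∧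
    ∃ _ : ModelCategory (DiagMod (coverDiagram U)),
      (∀ {F G : DiagMod (coverDiagram U)} (φ : F ⟶ G),
        WeakEquivalence φ ↔ ∀ α : CoverNerve U, QuasiIso (φ.app α)) ∧
      (∀ {F G : DiagMod (coverDiagram U)} (φ : F ⟶ G),
        Fibration φ ↔ ∀ (α : CoverNerve U) (n : ℤ), Function.Surjective ((φ.app α).f n)) ∧
      (∀ {F G : DiagMod (coverDiagram U)} (φ : F ⟶ G),
        Cofibration φ ↔
          ∀ α : CoverNerve U, DGMod.cof ((coverDiagram U).obj α) (DiagMod.relLatchingMap φ α)) ∧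
      (trivialCofibrations (DiagMod (coverDiagram U))).HasFunctorialFactorization
        (fibrations (DiagMod (coverDiagram U))) ∧
      (cofibrations (DiagMod (coverDiagram U))).HasFunctorialFactorization
        (trivialFibrations (DiagMod (coverDiagram U))) :=
  theorem3p9_general (coverDiagram U)
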